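/- Let $(\rho_i)_{i\ge -1}$ be a dyadic partition of unity of $\mathbb{R}^d$: the functions $\rho_i:\mathbb{R}^d\to[0,1]$ are smooth, radial and compactly supported, $\operatorname{supp}\rho_{-1}\subset\{|x|<\frac43\}$, $\operatorname{supp}\rho_0\subset\{\frac34<|x|<\frac83\}$, $\rho_i(x)=\rho_0(2^{-i}x)$ for $i\ge0$, and $\sum_{i\ge-1}\rho_i=1$. For a tempered distribution $u$ on $\mathbb{R}^d$ set $\Delta_i u:=\mathscr{F}^{-1}(\rho_i\mathscr{F}u)$. For $\gamma\in\mathbb{R}$, let $\mathcal{C}^\gamma(\mathbb{R}^d)$ be the space of tempered distributions $u$ with $\sup_{i\ge-1}2^{\gamma i}\|\Delta_iu\|_{L^\infty}<\infty$. Write $$\mathsf{P}_uv:=\sum_{j}\ \sum_{i\le j-2}\Delta_iu\,\Delta_jv$$ for the paraproduct (as long as the series over $j$ converges in the space of tempered distributions), and, for $a,b\in L^\infty(\mathbb{R}^d)$, $$\mathsf{R}^\circ(a,b,c):=\mathsf{P}_a(\mathsf{P}_bc)-\mathsf{P}_{ab}c.$$ Let $\alpha>0$. Let $f\in L^\infty(\mathbb{R}^d)$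 and let $(a_n,b_n)_{1\le n\le N}$ be a finite family of elements of $L^\infty(\mathbb{R}^d)\times L^\infty(\mathbb{R}^d)$ such that, for all $x,y\in\mathbb{R}^d$, $$f(y)-f(x)=\sum_{n=1}^N a_n(x)\big(b_n(y)-b_n(x)\big)+f^\sharp_{yx},$$ where the remainder $f^\sharp$ satisfies $\sup_{x,y\in\mathbb{R}^d}|f^\sharp_{yx}|/|y-x|^\alpha<\infty$ (with $0/0:=0$). Then, for every $\beta\in\mathbb{R}$ and every $g\in\mathcal{C}^\beta(\mathbb{R}^d)$, the paraproducts in $\mathsf{R}^\circ(a_n,b_n,g)$, $1\le n\le N$, converge, and $$\sum_{n=1}^N\mathsf{R}^\circ(a_n,b_n,g)\in\mathcal{C}^{\alpha+\beta}(\mathbb{R}^d).$$ -/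

import Mathlib

open MeasureTheory TemperedDistribution
open scoped SchwartzMap FourierTransform ENNReal

noncomputable section

namespace Paracontrolled

/-- The space `ℝ^d` with its Euclidean norm and Lebesgue measure. -/
abbrev Rd (d : ℕ) : Type := EuclideanSpace ℝ (Fin d)

/-- A dyadic partition of unity `(ρ_i)_{i ≥ -1}` of `ℝ^d`. Indices are shifted by one, so that they
run over `ℕ`: `rho n` is `ρ_{n-1}`, and in particular `rho 0 = ρ_{-1}` and `rho 1 = ρ_0`. -/
structure DyadicPartition (d : ℕ) where
  /-- `rho n` is `ρ_{n-1}`. -/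
  rho : ℕ → Rd d → ℝ
  rho_mem_Icc : ∀ n x, rho n x ∈ Set.Icc (0 : ℝ) 1
  hasCompactSupport_rho : ∀ n, HasCompactSupport (rho n)
  contDiff_rho : ∀ n, ContDiff ℝ ((⊤ : ℕ∞) : WithTop ℕ∞) (rho n)
  radial : ∀ n x y, ‖x‖ = ‖y‖ → rho n x = rho n y
  tsupport_rho_zero : tsupport (rho 0) ⊆ {x | ‖x‖ < 4 / 3}
  tsupport_rho_one : tsupport (rho 1) ⊆ {x | 3 / 4 < ‖x‖ ∧ ‖x‖ < 8 / 3}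
  rho_scaling : ∀ (n : ℕ) x, rho (n + 1) x = rho 1 (((2 : ℝ) ^ n)⁻¹ • x)
  hasSum_rho : ∀ x, HasSum (fun n => rho n x) 1

variable {d : ℕ}

namespace DyadicPartition

variable (D : DyadicPartition d)

/-- The Littlewood-Paley block `Δ_{n-1} u = 𝓕⁻¹ (ρ_{n-1} 𝓕 u)` of a tempered distribution `u`. -/
def block (n : ℕ) : 𝓢'(Rd d, ℂ) →L[ℂ] 𝓢'(Rd d, ℂ) :=
  fourierMultiplierCLM ℂ (fun x => (D.rho n x : ℂ))

theorem hasCompactSupport_ofReal_rho (n : ℕ) :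
    HasCompactSupport (fun x => (D.rho n x : ℂ)) :=
  (D.hasCompactSupport_rho n).comp_left (g := fun t : ℝ => (t : ℂ)) Complex.ofReal_zero

theorem contDiff_ofReal_rho (n : ℕ) : ContDiff ℝ ((⊤ : ℕ∞) : WithTop ℕ∞) (fun x => (D.rho n x : ℂ)) :=
  Complex.ofRealCLM.contDiff.comp (D.contDiff_rho n)

/-- The function `ρ_{n-1}` as a Schwartz function. -/
def rhoSchwartz (n : ℕ) : 𝓢(Rd d, ℂ) :=
  (D.hasCompactSupport_ofReal_rho n).toSchwartzMap (D.contDiff_ofReal_rho n)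

/-- The kernel `Q_{n-1} = 𝓕⁻¹ ρ_{n-1}` of the Littlewood-Paley block `Δ_{n-1}`. -/
def kernel (n : ℕ) : 𝓢(Rd d, ℂ) := 𝓕⁻ (D.rhoSchwartz n)

/-- The Schwartz function `y ↦ Q_{n-1}(x - y)`. -/
def kernelAt (n : ℕ) (x : Rd d) : 𝓢(Rd d, ℂ) :=
  SchwartzMap.compSubConstCLM ℂ x
    (SchwartzMap.compCLMOfContinuousLinearEquiv ℂ (ContinuousLinearEquiv.neg ℝ) (D.kernel n))

theorem kernelAt_apply (n : ℕ) (x y : Rd d) : D.kernelAt n x y = D.kernel n (x - y) := by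
  simp [kernelAt]

/-- The smooth function `x ↦ (Δ_{n-1} u)(x) = ⟨u, Q_{n-1}(x - ·)⟩`. -/
def blockFun (n : ℕ) (u : 𝓢'(Rd d, ℂ)) (x : Rd d) : ℂ := u (D.kernelAt n x)

end DyadicPartition

/-- The `L^∞` norm of a tempered distribution: the norm of the function in `L^∞` that represents it,
and `∞` if there is none. -/
def linftyNorm (u : 𝓢'(Rd d, ℂ)) : ℝ≥0∞ :=
  ⨅ (h : Lp ℂ ∞ (volume : Measure (Rd d))) (_ : (h : 𝓢'(Rd d, ℂ)) = u), ‖h‖ₑ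

namespace DyadicPartition

variable (D : DyadicPartition d)

/-- The Hölder-Besov norm `sup_{i ≥ -1} 2^{γ i} ‖Δ_i u‖_{L^∞}`, with `i = n - 1`. -/
def holderNorm (γ : ℝ) (u : 𝓢'(Rd d, ℂ)) : ℝ≥0∞ :=
  ⨆ n : ℕ, ENNReal.ofReal ((2 : ℝ) ^ (γ * ((n : ℝ) - 1))) * linftyNorm (D.block n u)

/-- The tempered distribution `u` belongs to `C^γ(ℝ^d) = B^γ_{∞,∞}(ℝ^d)`. -/
def MemHolder (γ : ℝ) (u : 𝓢'(Rd d, ℂ)) : Prop := D.holderNorm γ u < ∞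

/-- The term `∑_{i ≤ j - 2} Δ_i u Δ_j v` of the paraproduct, with `j = n - 1` and `i = m - 1`. Here
`Δ_i u` is a smooth function of temperate growth, which multiplies the distribution `Δ_j v`. -/
def paraTerm (u v : 𝓢'(Rd d, ℂ)) (n : ℕ) : 𝓢'(Rd d, ℂ) :=
  ∑ m ∈ Finset.range (n - 1), smulLeftCLM ℂ (D.blockFun m u) (D.block n v)

/-- The series that defines the paraproduct `P_u v` converges (in the space of tempered
distributions). -/
def ParaConverges (u v : 𝓢'(Rd d, ℂ)) : Prop := Summable (D.paraTerm u v)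

/-- Bony's paraproduct `P_u v = ∑_{i ≤ j - 2} Δ_i u Δ_j v`. -/
def para (u v : 𝓢'(Rd d, ℂ)) : 𝓢'(Rd d, ℂ) := ∑' n, D.paraTerm u v n

end DyadicPartition

/-- The tempered distribution defined by an essentially bounded function. -/
def distOf (f : Rd d → ℂ) (hf : MemLp f ∞ volume) : 𝓢'(Rd d, ℂ) :=
  ((hf.toLp f : Lp ℂ ∞ (volume : Measure (Rd d))) : 𝓢'(Rd d, ℂ))

theorem memLp_top_mul {a b : Rd d → ℂ} (ha : MemLp a ∞ volume) (hb : MemLp b ∞ volume) :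
    MemLp (fun x => a x * b x) ∞ volume :=
  hb.mul (r := ∞) ha

namespace DyadicPartition

variable (D : DyadicPartition d)

/-- The operator `R°(a, b, v) = P_a (P_b v) - P_{ab} v`, for `a, b` in `L^∞`. -/
def Rcirc (a b : Rd d → ℂ) (ha : MemLp a ∞ volume) (hb : MemLp b ∞ volume)
    (v : 𝓢'(Rd d, ℂ)) : 𝓢'(Rd d, ℂ) :=
  D.para (distOf a ha) (D.para (distOf b hb) v)
    - D.para (distOf (fun x => a x * b x) (memLp_top_mul ha hb)) v

/-- The three paraproducts in `R°(a, b, v)` converge. -/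
def RcircConverges (a b : Rd d → ℂ) (ha : MemLp a ∞ volume) (hb : MemLp b ∞ volume)
    (v : 𝓢'(Rd d, ℂ)) : Prop :=
  D.ParaConverges (distOf b hb) v
    ∧ D.ParaConverges (distOf a ha) (D.para (distOf b hb) v)
    ∧ D.ParaConverges (distOf (fun x => a x * b x) (memLp_top_mul ha hb)) v

end DyadicPartition

/-- The two-parameter Hölder norm `sup_{y,z} |F(y,z)| / |y-z|^α`. In `[0, ∞]` one has `0 / 0 = 0` and
`c / 0 = ∞` for `c ≠ 0`, so that it is infinite unless `F` vanishes on the diagonal. -/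
def twoParamHolderNorm (α : ℝ) (F : Rd d → Rd d → ℂ) : ℝ≥0∞ :=
  ⨆ (y : Rd d) (z : Rd d), ‖F y z‖ₑ / ‖y - z‖ₑ ^ α

end Paracontrolled

end

/-!
The `k`-th terms of the paraproducts with `a_n` and `a_n b_n` multiply by the averages `K ∗ a_n` and
`K ∗ (a_n b_n)`, where the kernel `K` has integral `1` and lives at scale `2^{-k}`. Write
`T F = Δ_k (P_F g)`, so that `T 1 = Δ_k g` for large `k`. The `k`-th term of `∑ R°(a_n, b_n, g)` is
then `∑ ((K ∗ a_n) T b_n - (K ∗ (a_n b_n)) T 1)`. Subtract `T f - (K ∗ f) T 1`, which sums to zero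
over `k` since both of its parts sum to `P_f g`. Because `K` has integral `1`, what is left is at
the point `z`, up to sign, the average over `x` with weight `K (z - x)` of the value at `z` of `T`
applied to `y ↦ f(y) - f(x) - ∑ a_n(x) (b_n(y) - b_n(x)) = f♯_{yx}`. This function is of size at
most `2^{-αk} (1 + 2^k |y - x|)^α`, up to a constant, and `T` consists of multiplications by blocks
of `g`, which are of size `2^{-βk}`, and of convolutions with kernels at scale `2^{-k}`, which
respect such weights. Hence what is left is of size `2^{-(α+β)k}`.

The terms have Fourier support in annuli of size `2^k`. Therefore a series with terms of size
`2^{-γk}` converges for every real `γ`, and `Δ_m` of its sum only involves the terms with `k` close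
to `m`.
-/

noncomputable section

namespace Paracontrolled

/-! ### Bounded functions and convolutions -/

section InnerProductSpace

variable {E : Type*} [NormedAddCommGroup E]

theorem one_add_norm_rpow_neg_le {x x' y : E} (h : x' ∈ Metric.ball x 1) {r : ℝ} (hr : 0 ≤ r) :
    (1 + ‖x' - y‖) ^ (-r) ≤ 2 ^ r * (1 + ‖x - y‖) ^ (-r) := by
  have hle : 1 + ‖x - y‖ ≤ 2 * (1 + ‖x' - y‖) := by
    have htri := norm_sub_le_norm_sub_add_norm_sub x x' y
    rw [Metric.mem_ball', dist_eq_norm] at h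
    linarith [norm_nonneg (x' - y)]
  rw [Real.rpow_neg (by positivity), Real.rpow_neg (by positivity), ← div_eq_mul_inv,
    le_div_iff₀ (by positivity), inv_mul_le_iff₀ (by positivity), mul_comm,
    ← Real.mul_rpow (by positivity) (by positivity)]
  exact Real.rpow_le_rpow (by positivity) hle hr

theorem one_add_mul_enorm_rpow_le {α : ℝ} (hα : 0 ≤ α) (l : ℝ≥0∞) (x y z : E) :
    (1 + l * ‖y - x‖ₑ) ^ α ≤ (1 + l * ‖z - x‖ₑ) ^ α * (1 + l * ‖z - y‖ₑ) ^ α := by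
  rw [← ENNReal.mul_rpow_of_nonneg _ _ hα]
  refine ENNReal.rpow_le_rpow ?_ hα
  have htri : ‖y - x‖ₑ ≤ ‖z - x‖ₑ + ‖z - y‖ₑ := by
    simpa using enorm_sub_le (a := z - x) (b := z - y)
  calc 1 + l * ‖y - x‖ₑ ≤ 1 + l * (‖z - x‖ₑ + ‖z - y‖ₑ) := by gcongr
    _ ≤ 1 + l * (‖z - x‖ₑ + ‖z - y‖ₑ) + l * ‖z - x‖ₑ * (l * ‖z - y‖ₑ) := le_self_add
    _ = (1 + l * ‖z - x‖ₑ) * (1 + l * ‖z - y‖ₑ) := by ring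

variable [InnerProductSpace ℝ E]

theorem exists_norm_iteratedFDeriv_le_rpow_neg {V : Type*} [NormedAddCommGroup V] [NormedSpace ℝ V]
    (K : 𝓢(E, V)) (n r : ℕ) :
    ∃ C : ℝ, ∀ z, ‖iteratedFDeriv ℝ n K z‖ ≤ C * (1 + ‖z‖) ^ (-(r : ℝ)) := by
  refine ⟨2 ^ r * ((Finset.Iic (r, n)).sup fun m => SchwartzMap.seminorm ℝ m.1 m.2) K,
    fun z => ?_⟩
  have h := SchwartzMap.one_add_le_sup_seminorm_apply (𝕜 := ℝ) (m := (r, n)) le_rfl le_rfl K z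
  rw [Real.rpow_neg (by positivity), Real.rpow_natCast, ← div_eq_mul_inv,
    le_div_iff₀ (by positivity), mul_comm]
  exact h

variable [FiniteDimensional ℝ E] [MeasurableSpace E] [BorelSpace E]

variable (E) in
/-- The algebra of essentially bounded complex functions on `E`. Its elements are functions rather
than classes modulo null sets, because the argument evaluates them at points. -/
def LInfty : Subalgebra ℂ (E → ℂ) where
  carrier := {F | MemLp F ∞ volume}
  add_mem' hF hG := hF.add hG
  mul_mem' hF hG := hG.mul (r := ∞) hF
  algebraMap_mem' c := memLp_top_const c

theorem LInfty.ae_enorm_le (F : LInfty E) : ∀ᵐ x, ‖F.1 x‖ₑ ≤ eLpNorm F.1 ∞ volume :=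
  eLpNorm_exponent_top (f := F.1) (μ := volume) ▸ ae_le_eLpNormEssSup

theorem LInfty.ae_norm_le (F : LInfty E) : ∀ᵐ x, ‖F.1 x‖ ≤ (eLpNorm F.1 ∞ volume).toReal := by
  filter_upwards [LInfty.ae_enorm_le F] with x hx
  simpa only [toReal_enorm] using ENNReal.toReal_mono F.2.eLpNorm_ne_top hx

theorem LInfty.integrable_smul {V : Type*} [NormedAddCommGroup V] [NormedSpace ℂ V] (F : LInfty E)
    {φ : E → V} (hφ : Integrable φ) : Integrable (fun y => F.1 y • φ y) :=
  hφ.bdd_smul _ F.2.1 (LInfty.ae_norm_le F)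

theorem LInfty.integrable_mul (F : LInfty E) {φ : E → ℂ} (hφ : Integrable φ) :
    Integrable (fun y => F.1 y * φ y) :=
  LInfty.integrable_smul F hφ

theorem LInfty.norm_integral_smul_le {V : Type*} [NormedAddCommGroup V] [NormedSpace ℂ V]
    (F : LInfty E) {φ : E → V} (hφ : Integrable φ) :
    ‖∫ y, F.1 y • φ y‖ ≤ (eLpNorm F.1 ∞ volume).toReal * ∫ y, ‖φ y‖ := by
  rw [← integral_const_mul]
  refine norm_integral_le_of_norm_le (hφ.norm.const_mul _) ?_
  filter_upwards [LInfty.ae_norm_le F] with y hy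
  rw [norm_smul]
  gcongr

section Smoothness

variable {V : Type*} [NormedAddCommGroup V] [NormedSpace ℂ V]

theorem integrable_iteratedFDeriv_comp_sub (K : 𝓢(E, V)) (n : ℕ) (x : E) :
    Integrable (fun y => iteratedFDeriv ℝ n K (x - y)) := by
  refine Integrable.comp_sub_left (f := iteratedFDeriv ℝ n K) ?_ x
  refine (integrable_norm_iff ?_).1 ?_
  · exact (K.smooth n).continuous_iteratedFDeriv le_rfl |>.aestronglyMeasurable
  · simpa using K.integrable_pow_mul_iteratedFDeriv volume 0 n

theorem integral_curryLeft {n : ℕ} (Φ : E → E [×(n + 1)]→L[ℝ] V) :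
    ∫ y, (Φ y).curryLeft = (∫ y, Φ y).curryLeft := by
  have hcomm := fun L => ContinuousLinearEquiv.integral_comp_comm (𝕜 := ℝ) (μ := volume)
    (E := E [×(n + 1)]→L[ℝ] V) (F := E →L[ℝ] E [×n]→L[ℝ] V) L Φ
  exact hcomm (continuousMultilinearCurryLeftEquiv ℝ (fun _ => E) V).toContinuousLinearEquiv

theorem LInfty.hasFDerivAt_integral_smul_iteratedFDeriv (F : LInfty E) (K : 𝓢(E, V)) (n : ℕ)
    (x : E) :
    HasFDerivAt (fun x => ∫ y, F.1 y • iteratedFDeriv ℝ n K (x - y))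
      (∫ y, F.1 y • iteratedFDeriv ℝ (n + 1) K (x - y)).curryLeft x := by
  set r := Module.finrank ℝ E + 1
  let L := continuousMultilinearCurryLeftEquiv ℝ (fun _ : Fin (n + 1) => E) V
  obtain ⟨B, hB⟩ := exists_norm_iteratedFDeriv_le_rpow_neg K (n + 1) r
  have hint (n : ℕ) (x' : E) : Integrable (fun y => F.1 y • iteratedFDeriv ℝ n K (x' - y)) :=
    LInfty.integrable_smul F (integrable_iteratedFDeriv_comp_sub K n x')
  rw [← integral_curryLeft]
  refine hasFDerivAt_integral_of_dominated_of_fderiv_le (𝕜 := ℝ)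
    (bound := fun y => (eLpNorm F.1 ∞ volume).toReal *
      (B * (2 ^ (r : ℝ) * (1 + ‖x - y‖) ^ (-(r : ℝ)))))
    (F' := fun x' y => (F.1 y • iteratedFDeriv ℝ (n + 1) K (x' - y)).curryLeft)
    (Metric.ball_mem_nhds x one_pos) (.of_forall fun x' => (hint n x').aestronglyMeasurable)
    (hint n x) (L.continuous.comp_aestronglyMeasurable (hint (n + 1) x).aestronglyMeasurable)
    ?_ ?_ (.of_forall fun y x' _ => ?_)
  · filter_upwards [LInfty.ae_norm_le F] with y hy x' hx'
    have hB0 : 0 ≤ B := by simpa using (norm_nonneg _).trans (hB 0)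
    rw [ContinuousMultilinearMap.curryLeft_norm, norm_smul]
    gcongr
    refine (hB _).trans ?_
    gcongr
    exact one_add_norm_rpow_neg_le hx' (by positivity)
  · have h_int : Integrable (fun z : E => (1 + ‖z‖) ^ (-(r : ℝ))) :=
      integrable_one_add_norm (by simp [r])
    exact (((h_int.comp_sub_left x).const_mul _).const_mul _).const_mul _
  · have hdiff : HasFDerivAt (iteratedFDeriv ℝ n K)
        (iteratedFDeriv ℝ (n + 1) K (x' - y)).curryLeft (x' - y) :=
      ((K.smooth (n + 1)).differentiable_iteratedFDeriv
        (by exact_mod_cast n.lt_succ_self) _).hasFDerivAt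
    have hcomp := hdiff.comp x' ((hasFDerivAt_id x').sub_const y)
    rw [ContinuousLinearMap.comp_id] at hcomp
    exact hcomp.const_smul (F.1 y)

theorem LInfty.hasTemperateGrowth_integral_mul (F : LInfty E) (K : 𝓢(E, ℂ)) :
    (fun x => ∫ y, F.1 y * K (x - y)).HasTemperateGrowth := by
  have hseries : HasFTaylorSeriesUpTo ((⊤ : ℕ∞) : WithTop ℕ∞) (fun x => ∫ y, F.1 y * K (x - y))
      fun x n => ∫ y, F.1 y • iteratedFDeriv ℝ n K (x - y) := by
    refine ⟨fun x => ?_, fun n _ x => ?_, fun n _ => ?_⟩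
    · rw [ContinuousMultilinearMap.curry0, ContinuousMultilinearMap.integral_apply
        (LInfty.integrable_smul F (integrable_iteratedFDeriv_comp_sub K 0 x))]
      rfl
    · exact LInfty.hasFDerivAt_integral_smul_iteratedFDeriv F K n x
    · exact continuous_iff_continuousAt.2 fun x =>
        (LInfty.hasFDerivAt_integral_smul_iteratedFDeriv F K n x).continuousAt
  refine ⟨hseries.contDiff, fun n => ⟨0, (eLpNorm F.1 ∞ volume).toReal *
    ∫ y, ‖iteratedFDeriv ℝ n K y‖, fun x => ?_⟩⟩
  rw [← hseries.eq_iteratedFDeriv (by exact_mod_cast le_top), pow_zero, mul_one]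
  refine (LInfty.norm_integral_smul_le F (integrable_iteratedFDeriv_comp_sub K n x)).trans_eq ?_
  rw [integral_sub_left_eq_self (fun y => ‖iteratedFDeriv ℝ n K y‖) volume x]

end Smoothness

/-- The convolution `x ↦ ∫ F(y) K(x - y) dy` of an essentially bounded function with a Schwartz
function, as an operator on essentially bounded functions. -/
def conv (K : 𝓢(E, ℂ)) : LInfty E →ₗ[ℂ] LInfty E where
  toFun F := ⟨fun x => ∫ y, F.1 y * K (x - y), memLp_top_of_bound
    (LInfty.hasTemperateGrowth_integral_mul F K).1.continuous.aestronglyMeasurable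
    ((eLpNorm F.1 ∞ volume).toReal * ∫ y, ‖K y‖) <| .of_forall fun x =>
      (LInfty.norm_integral_smul_le F (K.integrable.comp_sub_left x)).trans_eq <| by
        rw [integral_sub_left_eq_self (fun y => ‖K y‖) volume x]⟩
  map_add' F G := Subtype.ext <| funext fun x => by
    simpa only [AddMemClass.coe_add, Pi.add_apply, add_mul] using
      integral_add (LInfty.integrable_mul F (K.integrable.comp_sub_left x))
        (LInfty.integrable_mul G (K.integrable.comp_sub_left x))
  map_smul' c F := Subtype.ext <| funext fun x => by
    simpa only [SetLike.val_smul, Pi.smul_apply, smul_mul_assoc,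
      RingHom.id_apply] using
      integral_smul c (fun y => F.1 y * K (x - y))

theorem conv_apply (K : 𝓢(E, ℂ)) (F : LInfty E) (x : E) :
    (conv K F).1 x = ∫ y, F.1 y * K (x - y) :=
  rfl

theorem hasTemperateGrowth_conv (K : 𝓢(E, ℂ)) (F : LInfty E) :
    (conv K F).1.HasTemperateGrowth :=
  LInfty.hasTemperateGrowth_integral_mul F K

theorem conv_one_apply (K : 𝓢(E, ℂ)) (x : E) : (conv K 1).1 x = ∫ y, K y := by
  simpa only [conv_apply, OneMemClass.coe_one, Pi.one_apply, one_mul] using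
    integral_sub_left_eq_self (fun y => K y) volume x

theorem conv_sum {ι : Type*} (s : Finset ι) (K : ι → 𝓢(E, ℂ)) (F : LInfty E) :
    conv (∑ i ∈ s, K i) F = ∑ i ∈ s, conv (K i) F := by
  refine Subtype.ext <| funext fun x => ?_
  simp only [conv_apply, AddSubmonoidClass.coe_finsetSum, Finset.sum_apply, sum_apply,
    Finset.mul_sum]
  exact integral_finsetSum _ fun i _ =>
    LInfty.integrable_mul F ((K i).integrable.comp_sub_left x)

/-- The weighted integral `∫ |K(z)| (1 + l |z|)^α dz`. -/
def moment (α : ℝ) (l : ℝ≥0∞) (K : 𝓢(E, ℂ)) : ℝ≥0∞ := ∫⁻ z, ‖K z‖ₑ * (1 + l * ‖z‖ₑ) ^ α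

theorem moment_zero (l : ℝ≥0∞) (K : 𝓢(E, ℂ)) : moment 0 l K = eLpNorm K 1 volume := by
  simp [moment, eLpNorm_one_eq_lintegral_enorm]

theorem moment_le_of_le_mul {α : ℝ} (hα : 0 ≤ α) {l l' c : ℝ≥0∞} (hc : 1 ≤ c) (h : l ≤ c * l')
    (K : 𝓢(E, ℂ)) : moment α l K ≤ c ^ α * moment α l' K := by
  have hmeas : Measurable fun z => ‖K z‖ₑ * (1 + l' * ‖z‖ₑ) ^ α :=
    K.continuous.measurable.enorm.mul (by fun_prop)
  rw [moment, moment, ← lintegral_const_mul _ hmeas]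
  refine lintegral_mono fun z => ?_
  rw [mul_left_comm, ← ENNReal.mul_rpow_of_nonneg _ _ hα, mul_add, mul_one, ← mul_assoc c]
  gcongr

theorem enorm_conv_le_of_weight {α : ℝ} (hα : 0 ≤ α) {l B : ℝ≥0∞} {F : LInfty E} {x : E}
    (hF : ∀ᵐ y, ‖F.1 y‖ₑ ≤ B * (1 + l * ‖y - x‖ₑ) ^ α) (K : 𝓢(E, ℂ)) (z : E) :
    ‖(conv K F).1 z‖ₑ ≤ moment α l K * B * (1 + l * ‖z - x‖ₑ) ^ α := by
  have hmeas : Measurable fun y => ‖K (z - y)‖ₑ * (1 + l * ‖z - y‖ₑ) ^ α := by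
    have hsub : Continuous (z - ·) := continuous_const.sub continuous_id
    have hK := (K.continuous.comp hsub).measurable
    exact hK.enorm.mul (by fun_prop)
  calc ‖(conv K F).1 z‖ₑ
      ≤ ∫⁻ y, ‖F.1 y * K (z - y)‖ₑ := enorm_integral_le_lintegral_enorm _
    _ ≤ ∫⁻ y, B * (1 + l * ‖z - x‖ₑ) ^ α * (‖K (z - y)‖ₑ * (1 + l * ‖z - y‖ₑ) ^ α) := by
        refine lintegral_mono_ae ?_
        filter_upwards [hF] with y hy
        rw [enorm_mul]
        calc ‖F.1 y‖ₑ * ‖K (z - y)‖ₑ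
            ≤ B * ((1 + l * ‖z - x‖ₑ) ^ α * (1 + l * ‖z - y‖ₑ) ^ α) * ‖K (z - y)‖ₑ := by
              gcongr
              exact hy.trans (by gcongr; exact one_add_mul_enorm_rpow_le hα l x y z)
          _ = _ := by ring
    _ = B * (1 + l * ‖z - x‖ₑ) ^ α * moment α l K := by
        rw [lintegral_const_mul _ hmeas,
          lintegral_sub_left_eq_self (fun y => ‖K y‖ₑ * (1 + l * ‖y‖ₑ) ^ α) z, moment]
    _ = _ := by ring

theorem eLpNorm_conv_le (K : 𝓢(E, ℂ)) (F : LInfty E) :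
    eLpNorm (conv K F).1 ∞ volume ≤ eLpNorm K 1 volume * eLpNorm F.1 ∞ volume := by
  refine (eLpNorm_exponent_top (f := (conv K F).1)).trans_le <|
    eLpNormEssSup_le_of_ae_enorm_bound <|
    .of_forall fun z => ?_
  simpa [moment_zero] using enorm_conv_le_of_weight (α := 0) (l := 0) (x := 0) le_rfl
    (by simpa using LInfty.ae_enorm_le F) K z

theorem lintegral_enorm_mul_one_add_enorm_pow_lt_top (K : 𝓢(E, ℂ)) (n : ℕ) :
    ∫⁻ z, ‖K z‖ₑ * (1 + ‖z‖ₑ) ^ n < ∞ := by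
  set r := Module.finrank ℝ E + 1
  obtain ⟨C, hC⟩ := exists_norm_iteratedFDeriv_le_rpow_neg K 0 (n + r)
  have hdecay (z : E) : ‖K z‖ * (1 + ‖z‖) ^ n ≤ C * (1 + ‖z‖) ^ (-(r : ℝ)) :=
    calc ‖K z‖ * (1 + ‖z‖) ^ n ≤ C * (1 + ‖z‖) ^ (-((n + r : ℕ) : ℝ)) * (1 + ‖z‖) ^ n := by
          gcongr
          exact norm_iteratedFDeriv_zero (𝕜 := ℝ) (f := K) (x := z) ▸ hC z
      _ = C * (1 + ‖z‖) ^ (-(r : ℝ)) := by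
          rw [mul_assoc, ← Real.rpow_natCast, ← Real.rpow_add (by positivity)]
          push_cast
          ring_nf
  have hint : Integrable fun z : E => C * (1 + ‖z‖) ^ (-(r : ℝ)) :=
    (integrable_one_add_norm (by simp [r])).const_mul C
  refine (lintegral_mono fun z => ?_).trans_lt hint.lintegral_lt_top
  rw [← ofReal_norm, ← ofReal_norm, ← ENNReal.ofReal_one,
    ← ENNReal.ofReal_add zero_le_one (norm_nonneg z), ← ENNReal.ofReal_pow (by positivity),
    ← ENNReal.ofReal_mul (norm_nonneg _)]
  exact ENNReal.ofReal_le_ofReal (hdecay z)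

theorem moment_lt_top (α : ℝ) {l : ℝ≥0∞} (hl : l ≠ ∞) (K : 𝓢(E, ℂ)) : moment α l K < ∞ := by
  set n := ⌈α⌉₊
  have hweight (z : E) : (1 + l * ‖z‖ₑ) ^ α ≤ (1 + l) ^ n * (1 + ‖z‖ₑ) ^ n :=
    calc (1 + l * ‖z‖ₑ) ^ α ≤ (1 + l * ‖z‖ₑ) ^ (n : ℝ) :=
          ENNReal.rpow_le_rpow_of_exponent_le le_self_add (Nat.le_ceil α)
      _ = (1 + l * ‖z‖ₑ) ^ n := ENNReal.rpow_natCast _ _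
      _ ≤ ((1 + l) * (1 + ‖z‖ₑ)) ^ n := by
          gcongr
          rw [add_mul, one_mul]
          gcongr
          exacts [le_self_add, le_add_self]
      _ = (1 + l) ^ n * (1 + ‖z‖ₑ) ^ n := mul_pow _ _ _
  calc moment α l K ≤ ∫⁻ z, (1 + l) ^ n * (‖K z‖ₑ * (1 + ‖z‖ₑ) ^ n) := by
        refine lintegral_mono fun z => ?_
        rw [mul_left_comm]
        gcongr
        exact hweight z
    _ < ∞ := by
        rw [lintegral_const_mul' _ _ (by finiteness)]
        exact ENNReal.mul_lt_top (by finiteness)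
          (lintegral_enorm_mul_one_add_enorm_pow_lt_top K n)

/-! ### Fourier support and scaling -/

theorem fourier_translate (K : 𝓢(E, ℂ)) (y η : E) :
    𝓕 (K.compSubConstCLM ℂ y) η = Real.fourierChar (-inner ℝ y η) • 𝓕 K η := by
  have h := congrFun (VectorFourier.fourierIntegral_comp_add_right Real.fourierChar volume
    (innerₗ E) K (-y)) η
  simp only [map_neg, LinearMap.neg_apply, innerₗ_apply_apply] at h
  have hK : ⇑(K.compSubConstCLM ℂ y) = K ∘ fun v => v + -y := by
    ext v
    simp [sub_eq_add_neg]
  simp only [SchwartzMap.fourier_coe, hK]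
  exact h

theorem fourier_smul_fourierInv_apply (θ φ : 𝓢(E, ℂ)) (y : E) :
    𝓕 (SchwartzMap.smulLeftCLM ℂ θ (𝓕⁻ φ)) y = ∫ x, φ x * (𝓕⁻ θ) (x - y) := by
  have h := SchwartzMap.integral_fourier_mul_eq (𝓕⁻ φ) ((𝓕⁻ θ).compSubConstCLM ℂ y)
  simp only [FourierTransform.fourier_fourierInv_eq, SchwartzMap.compSubConstCLM_apply,
    fourier_translate] at h
  rw [h, SchwartzMap.fourier_coe, Real.fourier_eq]
  refine integral_congr_ae (.of_forall fun x => ?_)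
  simp only [SchwartzMap.smulLeftCLM_apply_apply θ.hasTemperateGrowth, real_inner_comm x y,
    Circle.smul_def, smul_eq_mul]
  ring

theorem integral_mul_conv (F : LInfty E) (K φ : 𝓢(E, ℂ)) :
    ∫ x, φ x * (conv K F).1 x = ∫ y, (∫ x, φ x * K (x - y)) * F.1 y := by
  have hint : Integrable (fun p : E × E => φ p.1 * K (p.1 - p.2)) (volume.prod volume) := by
    simpa [Function.comp_def] using
      ((φ.integrable (μ := volume)).convolution_integrand (ContinuousLinearMap.mul ℝ ℂ)
        K.integrable.comp_neg).swap
  have hF : ∀ᵐ p : E × E ∂volume.prod volume, ‖F.1 p.2‖ ≤ (eLpNorm F.1 ∞ volume).toReal :=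
    Measure.quasiMeasurePreserving_snd.ae (LInfty.ae_norm_le F)
  have hint' : Integrable (Function.uncurry fun x y => φ x * (F.1 y * K (x - y)))
      (volume.prod volume) :=
    (hint.bdd_mul F.2.1.comp_snd hF).congr (.of_forall fun p => mul_left_comm _ _ _)
  calc ∫ x, φ x * (conv K F).1 x = ∫ x, ∫ y, φ x * (F.1 y * K (x - y)) := by
        simp only [conv_apply, integral_const_mul]
    _ = ∫ y, ∫ x, φ x * (F.1 y * K (x - y)) := integral_integral_swap hint'
    _ = _ := by
        simp only [← integral_mul_const]
        refine integral_congr_ae (.of_forall fun y => integral_congr_ae (.of_forall fun x => ?_))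
        ring

/-- The Fourier transform of the tempered distribution `u` vanishes on every test function that
vanishes on `S`. This is slightly stronger than `supp 𝓕 u ⊆ S` when `S` is closed, as derivatives of
the test function are not required to vanish on `S`, and it spares the topology of `S`. -/
def FourierSupportedIn (S : Set E) (u : 𝓢'(E, ℂ)) : Prop :=
  ∀ ψ : 𝓢(E, ℂ), (∀ ξ ∈ S, ψ ξ = 0) → 𝓕 u ψ = 0

theorem FourierSupportedIn.fourierMultiplierCLM_congr {S : Set E} {u : 𝓢'(E, ℂ)}
    (hu : FourierSupportedIn S u) {θ θ' : E → ℂ} (hθ : θ.HasTemperateGrowth)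
    (hθ' : θ'.HasTemperateGrowth) (h : Set.EqOn θ θ' S) :
    fourierMultiplierCLM ℂ θ u = fourierMultiplierCLM ℂ θ' u := by
  ext φ
  rw [fourierMultiplierCLM_apply_apply, fourierMultiplierCLM_apply_apply,
    ← TemperedDistribution.fourier_apply, ← TemperedDistribution.fourier_apply, ← sub_eq_zero,
    ← map_sub]
  refine hu _ fun ξ hξ => ?_
  rw [sub_apply, SchwartzMap.smulLeftCLM_apply_apply hθ,
    SchwartzMap.smulLeftCLM_apply_apply hθ', h hξ, sub_self]

theorem fourierSupportedIn_fourierMultiplierCLM {S : Set E} {θ : E → ℂ}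
    (hθ : θ.HasTemperateGrowth) (h : ∀ ξ, θ ξ ≠ 0 → ξ ∈ S) (u : 𝓢'(E, ℂ)) :
    FourierSupportedIn S (fourierMultiplierCLM ℂ θ u) := fun ψ hψ => by
  have hzero : SchwartzMap.smulLeftCLM ℂ θ ψ = 0 := by
    ext ξ
    rw [SchwartzMap.smulLeftCLM_apply_apply hθ, zero_apply, smul_eq_zero]
    exact or_iff_not_imp_left.2 fun hξ => hψ ξ (h ξ hξ)
  rw [TemperedDistribution.fourier_apply, fourierMultiplierCLM_apply_apply,
    FourierTransform.fourierInv_fourier_eq, hzero, FourierTransform.fourier_zero, map_zero]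

theorem fourierInv_conv_smul_fourier_eq_zero (F : LInfty E) {θ ψ : 𝓢(E, ℂ)} {ξ : E}
    (h : ∀ η, θ η ≠ 0 → ψ (η + ξ) = 0) :
    𝓕⁻ (SchwartzMap.smulLeftCLM ℂ (conv (𝓕⁻ θ) F).1 (𝓕 ψ)) ξ = 0 := by
  set ψ' := ψ.compSubConstCLM ℂ (-ξ) with hψ'
  have hzero : SchwartzMap.smulLeftCLM ℂ θ ψ' = 0 := by
    ext η
    rw [SchwartzMap.smulLeftCLM_apply_apply θ.hasTemperateGrowth, hψ',
      SchwartzMap.compSubConstCLM_apply, sub_neg_eq_add, zero_apply, smul_eq_zero]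
    exact or_iff_not_imp_left.2 (h η)
  calc 𝓕⁻ (SchwartzMap.smulLeftCLM ℂ (conv (𝓕⁻ θ) F).1 (𝓕 ψ)) ξ
      = ∫ x, 𝓕 ψ' x * (conv (𝓕⁻ θ) F).1 x := by
        rw [SchwartzMap.fourierInv_coe, Real.fourierInv_eq]
        refine integral_congr_ae (.of_forall fun x => ?_)
        simp only [hψ', fourier_translate, inner_neg_left, neg_neg, real_inner_comm x ξ,
          SchwartzMap.smulLeftCLM_apply_apply (hasTemperateGrowth_conv _ F), Circle.smul_def,
          smul_eq_mul]
        ring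
    _ = 0 := by
        simp only [integral_mul_conv, ← fourier_smul_fourierInv_apply,
          FourierTransform.fourierInv_fourier_eq, hzero, FourierTransform.fourier_zero,
          zero_apply, zero_mul, integral_zero]

theorem FourierSupportedIn.smulLeftCLM_conv {S T : Set E} {u : 𝓢'(E, ℂ)}
    (hu : FourierSupportedIn T u) (F : LInfty E) {θ : 𝓢(E, ℂ)}
    (h : ∀ η ξ, θ η ≠ 0 → ξ ∈ T → η + ξ ∈ S) :
    FourierSupportedIn S (smulLeftCLM ℂ (conv (𝓕⁻ θ) F).1 u) := fun ψ hψ => by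
  rw [TemperedDistribution.fourier_apply, smulLeftCLM_apply_apply,
    ← FourierTransform.fourier_fourierInv_eq (E := 𝓢(E, ℂ)) (F := 𝓢(E, ℂ))
      (SchwartzMap.smulLeftCLM ℂ _ (𝓕 ψ)),
    ← TemperedDistribution.fourier_apply]
  exact hu _ fun ξ hξ => fourierInv_conv_smul_fourier_eq_zero F fun η hη => hψ _ (h η ξ hη hξ)

theorem fourierInv_scaling {θ θ' : 𝓢(E, ℂ)} {l : ℝ} (hl : 0 < l)
    (h : ∀ ξ, θ' ξ = θ (l⁻¹ • ξ)) (x : E) :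
    (𝓕⁻ θ') x = (l ^ Module.finrank ℝ E : ℝ) • (𝓕⁻ θ) (l • x) := by
  have hinner (v : E) : inner ℝ (l⁻¹ • v) (l • x) = (inner ℝ v x : ℝ) := by
    rw [real_inner_smul_left, real_inner_smul_right, ← mul_assoc, inv_mul_cancel₀ hl.ne', one_mul]
  have hsubst := Measure.integral_comp_smul volume
    (fun v : E => Real.fourierChar (inner ℝ v (l • x)) • θ v) l⁻¹
  simp only [hinner, ← h] at hsubst
  rw [SchwartzMap.fourierInv_coe, SchwartzMap.fourierInv_coe, Real.fourierInv_eq,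
    Real.fourierInv_eq, hsubst, abs_of_nonneg (by positivity), inv_pow, inv_inv]

theorem moment_fourierInv_scaling {θ θ' : 𝓢(E, ℂ)} {l : ℝ} (hl : 0 < l)
    (h : ∀ ξ, θ' ξ = θ (l⁻¹ • ξ)) (α : ℝ) :
    moment α (ENNReal.ofReal l) (𝓕⁻ θ') = moment α 1 (𝓕⁻ θ) := by
  set J := ENNReal.ofReal (l ^ Module.finrank ℝ E)
  have hJ : J ≠ 0 := by simpa [J] using pow_pos hl _
  have hpoint (z : E) : ‖(𝓕⁻ θ') z‖ₑ * (1 + ENNReal.ofReal l * ‖z‖ₑ) ^ α =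
      J * (‖(𝓕⁻ θ) (l • z)‖ₑ * (1 + 1 * ‖l • z‖ₑ) ^ α) := by
    rw [fourierInv_scaling hl h, enorm_smul, enorm_smul, Real.enorm_of_nonneg (by positivity),
      Real.enorm_of_nonneg hl.le, one_mul, mul_assoc]
  have hmap : J • Measure.map (l • ·) (volume : Measure E) = volume := by
    rw [Measure.map_addHaar_smul _ hl.ne', smul_smul, abs_of_nonneg (by positivity),
      ENNReal.ofReal_inv_of_pos (by positivity), ENNReal.mul_inv_cancel hJ ENNReal.ofReal_ne_top,
      one_smul]
  have hemb : MeasurableEmbedding (l • · : E → E) :=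
    (Homeomorph.smulOfNeZero l hl.ne').measurableEmbedding
  calc moment α (ENNReal.ofReal l) (𝓕⁻ θ')
      = J * ∫⁻ z, ‖(𝓕⁻ θ) (l • z)‖ₑ * (1 + 1 * ‖l • z‖ₑ) ^ α := by
        rw [moment, ← lintegral_const_mul' _ _ ENNReal.ofReal_ne_top]
        exact lintegral_congr hpoint
    _ = ∫⁻ z, ‖(𝓕⁻ θ) z‖ₑ * (1 + 1 * ‖z‖ₑ) ^ α ∂(J • Measure.map (l • ·) volume) := by
        rw [lintegral_smul_measure, hemb.lintegral_map, smul_eq_mul]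
    _ = moment α 1 (𝓕⁻ θ) := by rw [hmap, moment]

theorem eLpNorm_fourierInv_scaling {θ θ' : 𝓢(E, ℂ)} {l : ℝ} (hl : 0 < l)
    (h : ∀ ξ, θ' ξ = θ (l⁻¹ • ξ)) :
    eLpNorm (𝓕⁻ θ' : 𝓢(E, ℂ)) 1 volume = eLpNorm (𝓕⁻ θ : 𝓢(E, ℂ)) 1 volume := by
  rw [← moment_zero (ENNReal.ofReal l), moment_fourierInv_scaling hl h, moment_zero]

/-! ### Remainders of expansions -/

/-- The operator `T` maps functions of growth `B * (1 + l * ‖y - x‖) ^ α` to functions of growth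
`M * B * (1 + l * ‖y - x‖) ^ α`, for every centre `x`. -/
def WeightBound (α : ℝ) (l M : ℝ≥0∞) (T : LInfty E →ₗ[ℂ] LInfty E) : Prop :=
  ∀ (F : LInfty E) (x : E) (B : ℝ≥0∞), (∀ᵐ y, ‖F.1 y‖ₑ ≤ B * (1 + l * ‖y - x‖ₑ) ^ α) →
    ∀ z, ‖(T F).1 z‖ₑ ≤ M * B * (1 + l * ‖z - x‖ₑ) ^ α

theorem weightBound_conv_mul_conv {α : ℝ} (hα : 0 ≤ α) (l : ℝ≥0∞) (G : LInfty E)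
    (K K' : 𝓢(E, ℂ)) :
    WeightBound α l (moment α l K * eLpNorm G.1 ∞ volume * moment α l K')
      (conv K ∘ₗ LinearMap.mulRight ℂ G ∘ₗ conv K') := fun F x B hF z => by
  have hprod : ∀ᵐ y, ‖(conv K' F * G).1 y‖ₑ ≤
      eLpNorm G.1 ∞ volume * (moment α l K' * B) * (1 + l * ‖y - x‖ₑ) ^ α := by
    filter_upwards [LInfty.ae_enorm_le G] with y hy
    rw [MulMemClass.coe_mul, Pi.mul_apply, enorm_mul, mul_comm, mul_assoc]
    gcongr
    exact enorm_conv_le_of_weight hα hF K' y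
  refine (enorm_conv_le_of_weight hα hprod K z).trans_eq ?_
  ring

theorem WeightBound.mono {α : ℝ} {l M M' : ℝ≥0∞} {T : LInfty E →ₗ[ℂ] LInfty E}
    (hT : WeightBound α l M T) (h : M ≤ M') : WeightBound α l M' T :=
  fun F x B hF z => (hT F x B hF z).trans (by gcongr)

theorem WeightBound.sum {ι : Type*} {s : Finset ι} {α : ℝ} {l : ℝ≥0∞} {M : ι → ℝ≥0∞}
    {T : ι → LInfty E →ₗ[ℂ] LInfty E} (hT : ∀ i ∈ s, WeightBound α l (M i) (T i)) :
    WeightBound α l (∑ i ∈ s, M i) (∑ i ∈ s, T i) := fun F x B hF z => by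
  rw [LinearMap.sum_apply, AddSubmonoidClass.coe_finsetSum, Finset.sum_apply, Finset.sum_mul,
    Finset.sum_mul]
  exact (enorm_sum_le _ _).trans (Finset.sum_le_sum fun i hi => hT i hi F x B hF z)

section Remainder

variable {ι : Type*} [Fintype ι]

/-- The remainder `y ↦ f(y) - f(x) - ∑ aₙ(x) (bₙ(y) - bₙ(x))` of the expansion of `f` about `x`
along the functions `bₙ`. -/
def expansionRemainder (f : LInfty E) (a b : ι → LInfty E) (x : E) : LInfty E :=
  f - f.1 x • 1 - ∑ n, (a n).1 x • (b n - (b n).1 x • 1)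

/-- The defect `∑ ((K ∗ aₙ) T(bₙ) - (K ∗ (aₙ bₙ)) T(1))`, with a correction `T(f) - (K ∗ f) T(1)`
that turns it into an average of the functions `T(expansionRemainder f a b x)`. -/
def averagingDefect (K : 𝓢(E, ℂ)) (T : LInfty E →ₗ[ℂ] LInfty E) (f : LInfty E)
    (a b : ι → LInfty E) : LInfty E :=
  ∑ n, (conv K (a n) * T (b n) - conv K (a n * b n) * T 1) - (T f - conv K f * T 1)

theorem exists_conv_eq_neg_averagingDefect {K : 𝓢(E, ℂ)} (hK : ∫ y, K y = 1)
    (T : LInfty E →ₗ[ℂ] LInfty E) (f : LInfty E) (a b : ι → LInfty E) (z : E) :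
    ∃ S : LInfty E, (∀ x, S.1 x = (T (expansionRemainder f a b x)).1 z) ∧
      (conv K S).1 z = -(averagingDefect K T f a b).1 z := by
  refine ⟨(T f).1 z • 1 - (T 1).1 z • f -
    ∑ n, ((T (b n)).1 z • a n - (T 1).1 z • (a n * b n)), fun x => ?_, ?_⟩
  · simp only [expansionRemainder, map_sub, map_sum, map_smul, AddSubgroupClass.coe_sub,
      AddSubmonoidClass.coe_finsetSum, SetLike.val_smul, MulMemClass.coe_mul, OneMemClass.coe_one,
      Pi.sub_apply, Finset.sum_apply, Pi.smul_apply, Pi.mul_apply, Pi.one_apply, smul_eq_mul]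
    congr 1
    · ring
    · exact Finset.sum_congr rfl fun n _ => by ring
  · simp only [averagingDefect, map_sub, map_sum, map_smul, AddSubgroupClass.coe_sub,
      AddSubmonoidClass.coe_finsetSum, SetLike.val_smul, MulMemClass.coe_mul, Pi.sub_apply,
      Finset.sum_apply, Pi.smul_apply, Pi.mul_apply, smul_eq_mul, conv_one_apply, hK]
    rw [neg_sub]
    congr 1
    · ring
    · exact Finset.sum_congr rfl fun n _ => by ring

theorem enorm_averagingDefect_le {α : ℝ} (hα : 0 ≤ α) {l M B : ℝ≥0∞} {K : 𝓢(E, ℂ)}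
    (hK : ∫ y, K y = 1) {T : LInfty E →ₗ[ℂ] LInfty E} (hT : WeightBound α l M T) {f : LInfty E}
    {a b : ι → LInfty E}
    (h : ∀ x y, ‖(expansionRemainder f a b x).1 y‖ₑ ≤ B * (1 + l * ‖y - x‖ₑ) ^ α) (z : E) :
    ‖(averagingDefect K T f a b).1 z‖ₑ ≤ moment α l K * (M * B) := by
  obtain ⟨S, hS, hconv⟩ := exists_conv_eq_neg_averagingDefect hK T f a b z
  have hS_le : ∀ᵐ x, ‖S.1 x‖ₑ ≤ M * B * (1 + l * ‖x - z‖ₑ) ^ α := .of_forall fun x => by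
    rw [hS, enorm_sub_rev x z]
    exact hT _ x B (.of_forall (h x)) z
  rw [← enorm_neg, ← hconv]
  simpa using enorm_conv_le_of_weight hα hS_le K z

end Remainder

end InnerProductSpace

variable {d : ℕ}

/-! ### Tempered distributions represented by bounded functions -/

/-- The tempered distribution represented by an essentially bounded function. -/
def toDist : LInfty (Rd d) →ₗ[ℂ] 𝓢'(Rd d, ℂ) where
  toFun F := distOf F.1 F.2
  map_add' F G := map_add (Lp.toTemperedDistributionCLM ℂ volume ∞) (F.2.toLp F.1) (G.2.toLp G.1)
  map_smul' c F := map_smul (Lp.toTemperedDistributionCLM ℂ volume ∞) c (F.2.toLp F.1)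

theorem toDist_apply (F : LInfty (Rd d)) (φ : 𝓢(Rd d, ℂ)) :
    toDist F φ = ∫ x, φ x * F.1 x := by
  refine (Lp.toTemperedDistribution_apply _ φ).trans (integral_congr_ae ?_)
  filter_upwards [F.2.coeFn_toLp] with x hx
  rw [hx, smul_eq_mul]

theorem linftyNorm_toDist (F : LInfty (Rd d)) :
    linftyNorm (toDist F) = eLpNorm F.1 ∞ volume := by
  have hinj : Function.Injective (Lp.toTemperedDistributionCLM ℂ (volume : Measure (Rd d)) ∞) :=
    LinearMap.ker_eq_bot.1 Lp.ker_toTemperedDistributionCLM_eq_bot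
  rw [← Lp.enorm_toLp F.2]
  have hF : toDist F = Lp.toTemperedDistributionCLM ℂ volume ∞ (F.2.toLp F.1) := rfl
  refine le_antisymm (iInf₂_le (F.2.toLp F.1) hF.symm) (le_iInf₂ fun h hh => ?_)
  rw [show h = F.2.toLp F.1 from hinj hh]

theorem linftyNorm_ne_top_iff {u : 𝓢'(Rd d, ℂ)} :
    linftyNorm u ≠ ∞ ↔ u ∈ LinearMap.range toDist := by
  constructor
  · intro hu
    have hlt := hu.lt_top
    simp only [linftyNorm, iInf_lt_iff] at hlt
    obtain ⟨h, rfl, -⟩ := hlt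
    exact ⟨⟨h, Lp.memLp h⟩,
      congrArg (Lp.toTemperedDistributionCLM ℂ volume ∞) (Lp.toLp_coeFn h _)⟩
  · rintro ⟨F, rfl⟩
    exact (linftyNorm_toDist F).trans_ne F.2.2.ne

theorem linftyNorm_zero : linftyNorm (0 : 𝓢'(Rd d, ℂ)) = 0 := by
  rw [← map_zero toDist, linftyNorm_toDist]
  exact eLpNorm_zero

theorem linftyNorm_add_le (u v : 𝓢'(Rd d, ℂ)) :
    linftyNorm (u + v) ≤ linftyNorm u + linftyNorm v := by
  by_cases hu : linftyNorm u = ∞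
  · simp [hu]
  by_cases hv : linftyNorm v = ∞
  · simp [hv]
  obtain ⟨F, rfl⟩ := linftyNorm_ne_top_iff.1 hu
  obtain ⟨G, rfl⟩ := linftyNorm_ne_top_iff.1 hv
  rw [← map_add, linftyNorm_toDist, linftyNorm_toDist, linftyNorm_toDist]
  exact eLpNorm_add_le F.2.1 G.2.1 le_top

theorem linftyNorm_sum_le {ι : Type*} (s : Finset ι) (u : ι → 𝓢'(Rd d, ℂ)) :
    linftyNorm (∑ i ∈ s, u i) ≤ ∑ i ∈ s, linftyNorm (u i) :=
  Finset.le_sum_of_subadditive _ linftyNorm_zero.le linftyNorm_add_le s u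

theorem smulLeftCLM_toDist {F : LInfty (Rd d)} (hF : F.1.HasTemperateGrowth)
    (G : LInfty (Rd d)) : smulLeftCLM ℂ F.1 (toDist G) = toDist (F * G) := by
  ext φ
  rw [smulLeftCLM_apply_apply, toDist_apply, toDist_apply]
  refine integral_congr_ae (.of_forall fun x => ?_)
  simp only [SchwartzMap.smulLeftCLM_apply_apply hF, MulMemClass.coe_mul, Pi.mul_apply, smul_eq_mul]
  ring

theorem fourierMultiplierCLM_toDist (θ : 𝓢(Rd d, ℂ)) (F : LInfty (Rd d)) :
    fourierMultiplierCLM ℂ θ (toDist F) = toDist (conv (𝓕⁻ θ) F) := by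
  ext φ
  rw [fourierMultiplierCLM_apply_apply, toDist_apply, toDist_apply, integral_mul_conv]
  simp only [fourier_smul_fourierInv_apply]

theorem linftyNorm_smulLeftCLM_le {F : LInfty (Rd d)} (hF : F.1.HasTemperateGrowth)
    {u : 𝓢'(Rd d, ℂ)} (hu : linftyNorm u ≠ ∞) :
    linftyNorm (smulLeftCLM ℂ F.1 u) ≤ eLpNorm F.1 ∞ volume * linftyNorm u := by
  obtain ⟨G, rfl⟩ := linftyNorm_ne_top_iff.1 hu
  rw [smulLeftCLM_toDist hF, linftyNorm_toDist, linftyNorm_toDist]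
  change eLpNorm (F.1 • G.1) ∞ volume ≤ _
  exact eLpNorm_smul_le_mul_eLpNorm G.2.1 F.2.1

theorem linftyNorm_fourierMultiplierCLM_le (θ : 𝓢(Rd d, ℂ)) {u : 𝓢'(Rd d, ℂ)}
    (hu : linftyNorm u ≠ ∞) : linftyNorm (fourierMultiplierCLM ℂ θ u) ≤
      eLpNorm (𝓕⁻ θ : 𝓢(Rd d, ℂ)) 1 volume * linftyNorm u := by
  obtain ⟨F, rfl⟩ := linftyNorm_ne_top_iff.1 hu
  rw [fourierMultiplierCLM_toDist, linftyNorm_toDist, linftyNorm_toDist]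
  exact eLpNorm_conv_le _ F

/-! ### Dyadic decay -/

/-- The `L^∞` norms of the tempered distributions `u n` are `O(2^{-γ n})`. -/
def HasDyadicDecay (γ : ℝ) (u : ℕ → 𝓢'(Rd d, ℂ)) : Prop :=
  ∃ C : ℝ≥0∞, C ≠ ∞ ∧ ∀ n : ℕ, linftyNorm (u n) ≤ C * 2 ^ (-γ * n)

theorem two_rpow_add (s t : ℝ) : (2 : ℝ≥0∞) ^ (s + t) = 2 ^ s * 2 ^ t :=
  ENNReal.rpow_add s t two_ne_zero ENNReal.ofNat_ne_top

theorem two_rpow_ne_top (s : ℝ) : (2 : ℝ≥0∞) ^ s ≠ ∞ :=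
  ENNReal.rpow_ne_top_of_ne_zero two_ne_zero ENNReal.ofNat_ne_top

namespace HasDyadicDecay

variable {γ : ℝ} {u : ℕ → 𝓢'(Rd d, ℂ)}

theorem linftyNorm_ne_top (h : HasDyadicDecay γ u) (n : ℕ) : linftyNorm (u n) ≠ ∞ := by
  obtain ⟨C, hC, hu⟩ := h
  exact ne_top_of_le_ne_top (ENNReal.mul_ne_top hC (two_rpow_ne_top _)) (hu n)

theorem of_forall_ge {C : ℝ≥0∞} (hC : C ≠ ∞) {N : ℕ} (hfin : ∀ n, linftyNorm (u n) ≠ ∞)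
    (h : ∀ n ≥ N, linftyNorm (u n) ≤ C * 2 ^ (-γ * n)) : HasDyadicDecay γ u := by
  set C' := ∑ n ∈ Finset.range N, linftyNorm (u n) * 2 ^ (γ * n)
  refine ⟨max C C', max_lt hC.lt_top ?_ |>.ne, fun n => ?_⟩
  · exact ENNReal.sum_lt_top.2 fun n _ => (ENNReal.mul_ne_top (hfin n) (two_rpow_ne_top _)).lt_top
  rcases le_or_gt N n with hn | hn
  · exact (h n hn).trans (by gcongr; exact le_max_left _ _)
  calc linftyNorm (u n) = linftyNorm (u n) * 2 ^ (γ * n) * 2 ^ (-γ * n) := by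
        rw [mul_assoc, ← two_rpow_add, neg_mul, add_neg_cancel, ENNReal.rpow_zero, mul_one]
    _ ≤ C' * 2 ^ (-γ * n) := by
        gcongr
        exact Finset.single_le_sum (f := fun n : ℕ => linftyNorm (u n) * 2 ^ (γ * n))
          (fun _ _ => zero_le) (Finset.mem_range.2 hn)
    _ ≤ max C C' * 2 ^ (-γ * n) := by gcongr; exact le_max_right _ _

theorem smulLeft {F : ℕ → LInfty (Rd d)} (hF : ∀ n, (F n).1.HasTemperateGrowth) {C : ℝ≥0∞}
    (hC : C ≠ ∞) (hFC : ∀ n, eLpNorm (F n).1 ∞ volume ≤ C) (hu : HasDyadicDecay γ u) :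
    HasDyadicDecay γ fun n => smulLeftCLM ℂ (F n).1 (u n) := by
  have hfin := hu.linftyNorm_ne_top
  obtain ⟨B, hB, hu⟩ := hu
  refine ⟨C * B, ENNReal.mul_ne_top hC hB, fun n => ?_⟩
  rw [mul_assoc]
  exact (linftyNorm_smulLeftCLM_le (hF n) (hfin n)).trans (mul_le_mul' (hFC n) (hu n))

theorem fourierMultiplier {θ : ℕ → 𝓢(Rd d, ℂ)} {C : ℝ≥0∞} (hC : C ≠ ∞) {μ : ℝ}
    (hθ : ∀ n : ℕ, eLpNorm (𝓕⁻ (θ n) : 𝓢(Rd d, ℂ)) 1 volume ≤ C * 2 ^ (-μ * n))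
    (hu : HasDyadicDecay γ u) :
    HasDyadicDecay (μ + γ) fun n => fourierMultiplierCLM ℂ (θ n) (u n) := by
  have hfin := hu.linftyNorm_ne_top
  obtain ⟨B, hB, hu⟩ := hu
  refine ⟨C * B, ENNReal.mul_ne_top hC hB, fun n => ?_⟩
  calc linftyNorm (fourierMultiplierCLM ℂ (θ n) (u n))
      ≤ C * 2 ^ (-μ * n) * (B * 2 ^ (-γ * n)) :=
        (linftyNorm_fourierMultiplierCLM_le (θ n) (hfin n)).trans (mul_le_mul' (hθ n) (hu n))
    _ = C * B * 2 ^ (-(μ + γ) * n) := by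
        rw [neg_add, add_mul, two_rpow_add]
        ring

theorem comp_add_right (hu : HasDyadicDecay γ u) (m : ℕ) :
    HasDyadicDecay γ fun n => u (n + m) := by
  obtain ⟨C, hC, hu⟩ := hu
  refine ⟨C * 2 ^ (-γ * m), ENNReal.mul_ne_top hC (two_rpow_ne_top _), fun n =>
    (hu _).trans_eq ?_⟩
  rw [Nat.cast_add, mul_add, two_rpow_add]
  ring

theorem summable (hγ : 0 < γ) (hu : HasDyadicDecay γ u) : Summable u := by
  choose F hF using fun n => linftyNorm_ne_top_iff.1 (hu.linftyNorm_ne_top n)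
  obtain ⟨C, hC, hu⟩ := hu
  have hmem (n : ℕ) : MemLp (F n).1 ∞ volume := (F n).2
  have hnorm (n : ℕ) : ‖(hmem n).toLp (F n).1‖ ≤ C.toReal * ((2 : ℝ) ^ (-γ)) ^ n := by
    rw [Lp.norm_toLp, ← linftyNorm_toDist, hF]
    refine (ENNReal.toReal_mono (ENNReal.mul_ne_top hC (two_rpow_ne_top _)) (hu n)).trans_eq ?_
    rw [ENNReal.toReal_mul, ← ENNReal.toReal_rpow, ENNReal.toReal_ofNat, Real.rpow_mul two_pos.le,
      Real.rpow_natCast]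
  have hgeom : Summable fun n => C.toReal * ((2 : ℝ) ^ (-γ)) ^ n :=
    (summable_geometric_of_lt_one (by positivity)
      (Real.rpow_lt_one_of_one_lt_of_neg one_lt_two (neg_neg_of_pos hγ))).mul_left _
  exact funext hF ▸ (Summable.of_norm_bounded hgeom hnorm).map
    (Lp.toTemperedDistributionCLM ℂ volume ∞) (ContinuousLinearMap.continuous _)

end HasDyadicDecay

/-- The indices at distance at most `4` from `k`: those of the blocks that can meet the `k`-th term
of a paraproduct. -/
def window (k : ℕ) : Finset ℕ := Finset.Icc (k - 4) (k + 4)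

theorem mem_window {j k : ℕ} : j ∈ window k ↔ k ≤ j + 4 ∧ j ≤ k + 4 := by
  rw [window, Finset.mem_Icc]
  omega

theorem mem_window_comm {j k : ℕ} : j ∈ window k ↔ k ∈ window j := by
  rw [mem_window, mem_window, and_comm]

theorem card_window_le (k : ℕ) : (window k).card ≤ 9 := by
  rw [window, Nat.card_Icc]
  omega

theorem two_rpow_neg_mul_le_of_mem_window (γ : ℝ) {j k : ℕ} (h : j ∈ window k) :
    (2 : ℝ≥0∞) ^ (-γ * j) ≤ 2 ^ (4 * |γ|) * 2 ^ (-γ * k) := by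
  obtain ⟨hkj, hjk⟩ := mem_window.1 h
  have hdist : |(k : ℝ) - j| ≤ 4 := by
    rify at hkj hjk
    exact abs_le.2 ⟨by linarith, by linarith⟩
  rw [← two_rpow_add]
  refine ENNReal.rpow_le_rpow_of_exponent_le one_le_two ?_
  have hγ : γ * ((k : ℝ) - j) ≤ |γ| * 4 := (le_abs_self _).trans (by rw [abs_mul]; gcongr)
  linarith

theorem sum_window_le {γ : ℝ} {C : ℝ≥0∞} {k : ℕ} {c : ℕ → ℝ≥0∞}
    (h : ∀ j ∈ window k, c j ≤ C * 2 ^ (-γ * j)) :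
    ∑ j ∈ window k, c j ≤ 9 * C * 2 ^ (4 * |γ|) * 2 ^ (-γ * k) :=
  calc ∑ j ∈ window k, c j ≤ (window k).card • (C * (2 ^ (4 * |γ|) * 2 ^ (-γ * k))) :=
        Finset.sum_le_card_nsmul _ _ _ fun j hj => (h j hj).trans <| by
          gcongr
          exact two_rpow_neg_mul_le_of_mem_window γ hj
    _ ≤ 9 • (C * (2 ^ (4 * |γ|) * 2 ^ (-γ * k))) := by gcongr; exact card_window_le k
    _ = 9 * C * 2 ^ (4 * |γ|) * 2 ^ (-γ * k) := by
        rw [nsmul_eq_mul, Nat.cast_ofNat]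
        ring

theorem hasDyadicDecay_sum_window {γ : ℝ} {v : ℕ → ℕ → 𝓢'(Rd d, ℂ)} {C : ℝ≥0∞} (hC : C ≠ ∞)
    (hv : ∀ m k, linftyNorm (v m k) ≤ C * 2 ^ (-γ * k)) :
    HasDyadicDecay γ fun m => ∑ k ∈ window m, v m k :=
  ⟨9 * C * 2 ^ (4 * |γ|),
    ENNReal.mul_ne_top (ENNReal.mul_ne_top ENNReal.ofNat_ne_top hC) (two_rpow_ne_top _),
    fun m => (linftyNorm_sum_le _ _).trans (sum_window_le fun k _ => hv m k)⟩

namespace DyadicPartition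

theorem memHolder_iff (D : DyadicPartition d) {γ : ℝ} {u : 𝓢'(Rd d, ℂ)} :
    D.MemHolder γ u ↔ HasDyadicDecay γ fun n => D.block n u := by
  have hofReal (s : ℝ) : ENNReal.ofReal (2 ^ s) = 2 ^ s := by
    rw [← ENNReal.ofReal_rpow_of_pos two_pos, ENNReal.ofReal_ofNat]
  constructor
  · refine fun h => ⟨2 ^ γ * D.holderNorm γ u, ENNReal.mul_ne_top (two_rpow_ne_top _) h.ne,
      fun n => ?_⟩
    calc linftyNorm (D.block n u)
        = 2 ^ γ * (2 ^ (γ * ((n : ℝ) - 1)) * linftyNorm (D.block n u)) * 2 ^ (-γ * n) := by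
          rw [← mul_assoc, ← two_rpow_add, mul_right_comm, ← two_rpow_add]
          ring_nf
          rw [ENNReal.rpow_zero, one_mul]
      _ ≤ _ := by
          gcongr
          rw [← hofReal]
          exact le_iSup (fun n : ℕ => ENNReal.ofReal (2 ^ (γ * ((n : ℝ) - 1))) * _) n
  · rintro ⟨C, hC, h⟩
    refine (iSup_le fun n => ?_ : D.holderNorm γ u ≤ C * 2 ^ (-γ)).trans_lt
      (ENNReal.mul_ne_top hC (two_rpow_ne_top _)).lt_top
    calc _ ≤ 2 ^ (γ * ((n : ℝ) - 1)) * (C * 2 ^ (-γ * n)) := by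
          rw [hofReal]
          gcongr
          exact h n
      _ = C * 2 ^ (-γ) := by
          rw [mul_left_comm, ← two_rpow_add]
          ring_nf

end DyadicPartition

/-! ### Terms of the paraproduct -/

namespace DyadicPartition

variable (D : DyadicPartition d)

theorem rhoSchwartz_apply (n : ℕ) (x : Rd d) : D.rhoSchwartz n x = (D.rho n x : ℂ) := rfl

theorem block_eq (n : ℕ) : D.block n = fourierMultiplierCLM ℂ (D.rhoSchwartz n) := rfl

theorem norm_lt_of_rho_ne_zero {n : ℕ} {x : Rd d} (h : D.rho n x ≠ 0) :
    ‖x‖ < 4 / 3 * 2 ^ n := by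
  cases n with
  | zero => simpa using D.tsupport_rho_zero (subset_tsupport _ h)
  | succ n =>
    rw [D.rho_scaling] at h
    have hlt := (D.tsupport_rho_one (subset_tsupport _ h)).2
    rw [norm_smul, norm_inv, Real.norm_of_nonneg (by positivity), inv_mul_lt_iff₀ (by positivity)]
      at hlt
    rw [pow_succ]
    linarith

theorem lt_norm_of_rho_ne_zero {n : ℕ} (hn : n ≠ 0) {x : Rd d} (h : D.rho n x ≠ 0) :
    3 / 8 * 2 ^ n < ‖x‖ := by
  obtain ⟨n, rfl⟩ := Nat.exists_eq_succ_of_ne_zero hn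
  rw [Nat.succ_eq_add_one, D.rho_scaling] at h
  have hlt := (D.tsupport_rho_one (subset_tsupport _ h)).1
  rw [norm_smul, norm_inv, Real.norm_of_nonneg (by positivity), lt_inv_mul_iff₀ (by positivity)]
    at hlt
  rw [Nat.succ_eq_add_one, pow_succ]
  linarith

theorem rho_add {m : ℕ} (hm : m ≠ 0) (n : ℕ) (x : Rd d) :
    D.rho (m + n) x = D.rho m (((2 : ℝ) ^ n)⁻¹ • x) := by
  obtain ⟨m, rfl⟩ := Nat.exists_eq_succ_of_ne_zero hm
  rw [Nat.succ_eq_add_one, add_right_comm, D.rho_scaling (m + n), D.rho_scaling m, smul_smul,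
    pow_add, mul_inv]

theorem rho_apply_zero {n : ℕ} (hn : n ≠ 0) : D.rho n 0 = 0 := by
  by_contra h
  have hlt := D.lt_norm_of_rho_ne_zero hn h
  rw [norm_zero] at hlt
  exact hlt.not_ge (by positivity)

/-- The frequencies at which `rho m` vanishes for all `m` outside `window n`. -/
def windowSet (n : ℕ) : Set (Rd d) := {ξ | ∀ m, D.rho m ξ ≠ 0 → m ∈ window n}

theorem mem_windowSet_of_norm {n : ℕ} {ξ : Rd d} (hlt : ‖ξ‖ < 3 * 2 ^ n)
    (hgt : n ≠ 0 → 1 / 24 * 2 ^ n < ‖ξ‖) : ξ ∈ D.windowSet n := fun m hm => by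
  have hpow {i j : ℕ} (hij : i + 5 ≤ j) : (2 : ℝ) ^ i * 32 ≤ 2 ^ j :=
    (pow_le_pow_right₀ one_le_two hij).trans_eq' (by rw [pow_add]; norm_num)
  have hn₂ : (0 : ℝ) < 2 ^ n := by positivity
  refine mem_window.2 ⟨?_, ?_⟩ <;> by_contra! h
  · linarith [hpow h, hgt (by omega), D.norm_lt_of_rho_ne_zero hm]
  · linarith [hpow h, D.lt_norm_of_rho_ne_zero (by omega) hm, hn₂]

theorem mem_windowSet_of_rho_ne_zero {n : ℕ} {ξ : Rd d} (h : D.rho n ξ ≠ 0) :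
    ξ ∈ D.windowSet n := by
  have hpow : (0 : ℝ) < 2 ^ n := by positivity
  exact D.mem_windowSet_of_norm (by linarith [D.norm_lt_of_rho_ne_zero h])
    fun hn => by linarith [D.lt_norm_of_rho_ne_zero hn h]

theorem sum_window_rho_eq_one {n : ℕ} {ξ : Rd d} (h : ξ ∈ D.windowSet n) :
    ∑ m ∈ window n, D.rho m ξ = 1 :=
  (hasSum_sum_of_ne_finset_zero fun m hm => not_not.1 fun h₀ => hm (h m h₀)).unique (D.hasSum_rho ξ)

theorem block_eq_zero_of_fourierSupportedIn {m n : ℕ} {u : 𝓢'(Rd d, ℂ)}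
    (hu : FourierSupportedIn (D.windowSet n) u) (h : m ∉ window n) : D.block m u = 0 := by
  have hzero : Set.EqOn (D.rhoSchwartz m) (fun _ => 0) (D.windowSet n) := fun ξ hξ => by
    rw [rhoSchwartz_apply, not_not.1 fun h₀ => h (hξ m h₀), Complex.ofReal_zero]
  rw [block_eq, hu.fourierMultiplierCLM_congr (D.rhoSchwartz m).hasTemperateGrowth (.const 0) hzero,
    fourierMultiplierCLM_const, zero_smul, zero_apply]

theorem sum_window_block_block (k : ℕ) (u : 𝓢'(Rd d, ℂ)) :
    ∑ j ∈ window k, D.block k (D.block j u) = D.block k u := by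
  have hrho (n : ℕ) := (D.rhoSchwartz n).hasTemperateGrowth
  have hsum : (fun ξ => ∑ j ∈ window k, (⇑(D.rhoSchwartz j) * ⇑(D.rhoSchwartz k)) ξ) =
      D.rhoSchwartz k := by
    ext ξ
    simp only [Pi.mul_apply, rhoSchwartz_apply, ← Finset.sum_mul]
    by_cases hξ : D.rho k ξ = 0
    · simp only [hξ, Complex.ofReal_zero, mul_zero]
    · rw [← Complex.ofReal_sum, D.sum_window_rho_eq_one (D.mem_windowSet_of_rho_ne_zero hξ),
        Complex.ofReal_one, one_mul]
  simp only [block_eq, fourierMultiplierCLM_fourierMultiplierCLM_apply (hrho _) (hrho _)]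
  rw [← sum_apply, ← fourierMultiplierCLM_sum ℂ fun j _ => (hrho j).mul (hrho k), hsum]

/-- The Fourier multiplier `∑_{m < n - 1} rho m` that is applied to the first argument in the `n`-th
term of a paraproduct. -/
def lowSchwartz (n : ℕ) : 𝓢(Rd d, ℂ) := ∑ m ∈ Finset.range (n - 1), D.rhoSchwartz m

theorem lowSchwartz_apply (n : ℕ) (x : Rd d) :
    D.lowSchwartz n x = ((∑ m ∈ Finset.range (n - 1), D.rho m x : ℝ) : ℂ) := by
  rw [lowSchwartz, sum_apply, Complex.ofReal_sum]
  rfl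

theorem lowSchwartz_add_two_apply (n : ℕ) (x : Rd d) :
    D.lowSchwartz (n + 2) x = D.rhoSchwartz 0 (((2 : ℝ) ^ n)⁻¹ • x) := by
  have htail : (fun m => D.rho (m + (n + 1)) x) =
      fun m => D.rho (m + 1) (((2 : ℝ) ^ n)⁻¹ • x) := by
    ext m
    rw [← D.rho_add m.add_one_ne_zero, add_right_comm, add_assoc]
  have hx := (hasSum_nat_add_iff' (n + 1)).2 (D.hasSum_rho x)
  have hxn := (hasSum_nat_add_iff' 1).2 (D.hasSum_rho (((2 : ℝ) ^ n)⁻¹ • x))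
  rw [htail] at hx
  have heq := hx.unique hxn
  rw [Finset.sum_range_one] at heq
  rw [lowSchwartz_apply, rhoSchwartz_apply, show n + 2 - 1 = n + 1 by omega]
  exact congrArg Complex.ofReal (by linarith)

theorem norm_lt_of_lowSchwartz_ne_zero {n : ℕ} {x : Rd d} (h : D.lowSchwartz n x ≠ 0) :
    n ≠ 0 ∧ ‖x‖ < 1 / 3 * 2 ^ n := by
  rcases n with _ | _ | n
  · simp [lowSchwartz] at h
  · simp [lowSchwartz] at h
  · rw [lowSchwartz_add_two_apply, rhoSchwartz_apply, Complex.ofReal_ne_zero] at h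
    have hlt := D.norm_lt_of_rho_ne_zero h
    rw [norm_smul, norm_inv, Real.norm_of_nonneg (by positivity), inv_mul_lt_iff₀ (by positivity)]
      at hlt
    refine ⟨by omega, ?_⟩
    rw [pow_succ, pow_succ]
    linarith

theorem add_mem_windowSet {n : ℕ} {η ξ : Rd d} (hη : D.lowSchwartz n η ≠ 0)
    (hξ : D.rho n ξ ≠ 0) : η + ξ ∈ D.windowSet n := by
  obtain ⟨hn, hη_lt⟩ := D.norm_lt_of_lowSchwartz_ne_zero hη
  have hpow : (0 : ℝ) < 2 ^ n := by positivity
  refine D.mem_windowSet_of_norm ?_ fun _ => ?_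
  · linarith [norm_add_le η ξ, D.norm_lt_of_rho_ne_zero hξ]
  · linarith [add_comm η ξ ▸ norm_sub_le_norm_add ξ η, D.lt_norm_of_rho_ne_zero hn hξ]

/-- The kernel of the low-frequency projection in the `n`-th term of a paraproduct. -/
def lowKernel (n : ℕ) : 𝓢(Rd d, ℂ) := 𝓕⁻ (D.lowSchwartz n)

theorem lowKernel_eq_sum (n : ℕ) :
    D.lowKernel n = ∑ m ∈ Finset.range (n - 1), D.kernel m :=
  map_sum (FourierTransform.fourierInvCLM ℂ 𝓢(Rd d, ℂ)) _ _

theorem integral_lowKernel {n : ℕ} (hn : 2 ≤ n) : ∫ y, D.lowKernel n y = 1 := by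
  obtain ⟨n, rfl⟩ := Nat.exists_eq_add_of_le' hn
  have hfourier : 𝓕 (D.lowKernel (n + 2)) 0 = ∫ y, D.lowKernel (n + 2) y := by
    simp [SchwartzMap.fourier_coe, Real.fourier_eq]
  have hrho : D.rho 0 0 = 1 :=
    (hasSum_single 0 fun m hm => D.rho_apply_zero hm).unique (D.hasSum_rho 0)
  rw [← hfourier, lowKernel, FourierTransform.fourier_fourierInv_eq, lowSchwartz_add_two_apply,
    smul_zero, rhoSchwartz_apply, hrho, Complex.ofReal_one]

theorem moment_kernel_le {α : ℝ} (hα : 0 ≤ α) {n : ℕ} (hn : n ≠ 0) :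
    moment α (2 ^ n) (D.kernel n) ≤ 2 ^ α * moment α 1 (D.kernel 1) := by
  obtain ⟨n, rfl⟩ := Nat.exists_eq_succ_of_ne_zero hn
  have h := moment_fourierInv_scaling (by positivity : (0 : ℝ) < 2 ^ n)
    (θ := D.rhoSchwartz 1) (θ' := D.rhoSchwartz (n + 1))
    (fun ξ => congrArg Complex.ofReal (D.rho_scaling n ξ)) α
  rw [ENNReal.ofReal_pow two_pos.le, ENNReal.ofReal_ofNat] at h
  exact (moment_le_of_le_mul hα one_le_two (pow_succ' 2 n).le _).trans_eq (congrArg _ h)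

theorem moment_lowKernel_le {α : ℝ} (hα : 0 ≤ α) {n k : ℕ} (hn : 2 ≤ n) (hk : k ≤ n + 4) :
    moment α (2 ^ k) (D.lowKernel n) ≤ 64 ^ α * moment α 1 (D.kernel 0) := by
  obtain ⟨n, rfl⟩ := Nat.exists_eq_add_of_le' hn
  have h := moment_fourierInv_scaling (by positivity : (0 : ℝ) < 2 ^ n)
    (D.lowSchwartz_add_two_apply n) α
  rw [ENNReal.ofReal_pow two_pos.le, ENNReal.ofReal_ofNat] at h
  have hpow : (2 : ℝ≥0∞) ^ k ≤ 64 * 2 ^ n :=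
    (pow_le_pow_right₀ one_le_two hk).trans_eq (by ring)
  exact (moment_le_of_le_mul hα (by norm_num) hpow _).trans_eq (congrArg _ h)

theorem eLpNorm_kernel_le (n : ℕ) : eLpNorm (D.kernel n) 1 volume ≤
    max (eLpNorm (D.kernel 0) 1 volume) (eLpNorm (D.kernel 1) 1 volume) := by
  cases n with
  | zero => exact le_max_left _ _
  | succ n => exact le_max_of_le_right <| (eLpNorm_fourierInv_scaling (by positivity)
      fun ξ => congrArg Complex.ofReal (D.rho_scaling n ξ)).le

theorem eLpNorm_lowKernel_le (n : ℕ) :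
    eLpNorm (D.lowKernel n) 1 volume ≤ eLpNorm (D.kernel 0) 1 volume := by
  rcases n with _ | _ | n
  · simp [lowKernel_eq_sum]
  · simp [lowKernel_eq_sum]
  · exact (eLpNorm_fourierInv_scaling (by positivity) (D.lowSchwartz_add_two_apply n)).le

theorem blockFun_toDist (n : ℕ) (F : LInfty (Rd d)) :
    D.blockFun n (toDist F) = (conv (D.kernel n) F).1 := by
  ext x
  simp only [blockFun, toDist_apply, conv_apply, kernelAt_apply, mul_comm]

theorem paraTerm_toDist (F : LInfty (Rd d)) (v : 𝓢'(Rd d, ℂ)) (n : ℕ) :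
    D.paraTerm (toDist F) v n = smulLeftCLM ℂ (conv (D.lowKernel n) F).1 (D.block n v) := by
  have hsum : (conv (D.lowKernel n) F).1 =
      fun x => ∑ m ∈ Finset.range (n - 1), (conv (D.kernel m) F).1 x := by
    ext x
    rw [lowKernel_eq_sum, conv_sum, AddSubmonoidClass.coe_finsetSum, Finset.sum_apply]
  rw [hsum, smulLeftCLM_sum fun m _ => hasTemperateGrowth_conv _ F, sum_apply, paraTerm]
  simp only [blockFun_toDist]

theorem fourierSupportedIn_paraTerm (F : LInfty (Rd d)) (v : 𝓢'(Rd d, ℂ)) (n : ℕ) :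
    FourierSupportedIn (D.windowSet n) (D.paraTerm (toDist F) v n) := by
  rw [paraTerm_toDist]
  have hv : FourierSupportedIn {ξ | D.rho n ξ ≠ 0} (D.block n v) :=
    fourierSupportedIn_fourierMultiplierCLM (D.rhoSchwartz n).hasTemperateGrowth
      (fun ξ => Complex.ofReal_ne_zero.1) v
  exact hv.smulLeftCLM_conv F fun η ξ => D.add_mem_windowSet

theorem MemHolder.hasDyadicDecay_paraTerm {D : DyadicPartition d} {β : ℝ} {v : 𝓢'(Rd d, ℂ)}
    (hv : D.MemHolder β v) (F : LInfty (Rd d)) : HasDyadicDecay β (D.paraTerm (toDist F) v) := by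
  have hF : MemLp F.1 ∞ volume := F.2
  have hK : MemLp (D.kernel 0) 1 volume := (D.kernel 0).memLp 1
  rw [funext (D.paraTerm_toDist F v)]
  exact (D.memHolder_iff.1 hv).smulLeft (fun n => hasTemperateGrowth_conv _ F)
    (ENNReal.mul_ne_top hK.2.ne hF.2.ne)
    fun n => (eLpNorm_conv_le _ F).trans (mul_le_mul_left (D.eLpNorm_lowKernel_le n) _)

end DyadicPartition

/-! ### Convergence of paraproducts -/

theorem exists_mul_norm_sq_pow_eq {θ : 𝓢(Rd d, ℂ)} (hθ : HasCompactSupport θ)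
    (h₀ : 0 ∉ tsupport θ) (M : ℕ) :
    ∃ θ' : 𝓢(Rd d, ℂ), ∀ ξ, θ' ξ * ((‖ξ‖ ^ 2) ^ M : ℝ) = θ ξ := by
  have hnorm {ξ : Rd d} (hξ : ξ ≠ 0) : (((‖ξ‖ ^ 2) ^ M : ℝ) : ℂ) ≠ 0 :=
    Complex.ofReal_ne_zero.2 (pow_ne_zero _ (pow_ne_zero _ (norm_ne_zero_iff.2 hξ)))
  have hsmooth : ContDiff ℝ ((⊤ : ℕ∞) : WithTop ℕ∞)
      fun ξ => θ ξ * (((‖ξ‖ ^ 2) ^ M : ℝ) : ℂ)⁻¹ := by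
    refine contDiff_iff_contDiffAt.2 fun ξ => ?_
    rcases eq_or_ne ξ 0 with rfl | hξ
    · refine (contDiffAt_const (c := (0 : ℂ))).congr_of_eventuallyEq ?_
      filter_upwards [notMem_tsupport_iff_eventuallyEq.1 h₀] with η hη
      rw [hη, Pi.zero_apply, zero_mul]
    · exact θ.smooth'.contDiffAt.mul
        ((Complex.ofRealCLM.contDiff.comp ((contDiff_norm_sq ℝ).pow M)).contDiffAt.inv (hnorm hξ))
  refine ⟨hθ.mul_right.toSchwartzMap hsmooth, fun ξ => ?_⟩
  change θ ξ * (((‖ξ‖ ^ 2) ^ M : ℝ) : ℂ)⁻¹ * ((‖ξ‖ ^ 2) ^ M : ℝ) = θ ξ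
  rcases eq_or_ne ξ 0 with rfl | hξ
  · rw [image_eq_zero_of_notMem_tsupport h₀, zero_mul, zero_mul]
  · exact inv_mul_cancel_right₀ (hnorm hξ) _

theorem exists_eq_comp_smul (θ : 𝓢(Rd d, ℂ)) {c : ℝ} (hc : c ≠ 0) :
    ∃ θ' : 𝓢(Rd d, ℂ), ∀ ξ, θ' ξ = θ (c • ξ) :=
  ⟨SchwartzMap.compCLMOfContinuousLinearEquiv ℂ
    (ContinuousLinearEquiv.smulLeft (Units.mk0 c hc)) θ, fun _ => rfl⟩

namespace DyadicPartition

variable (D : DyadicPartition d)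

theorem zero_notMem_tsupport_rho_one : 0 ∉ tsupport (D.rho 1) := fun h => by
  have hlt := (D.tsupport_rho_one h).1
  rw [norm_zero] at hlt
  norm_num at hlt

theorem exists_mul_norm_sq_pow_eq_rhoSchwartz (M : ℕ) :
    ∃ C : ℝ≥0∞, C ≠ ∞ ∧ ∃ θ : ℕ → 𝓢(Rd d, ℂ), ∀ n : ℕ,
      (∀ ξ, θ n ξ * ((‖ξ‖ ^ 2) ^ M : ℝ) = D.rhoSchwartz (n + 1) ξ) ∧
      eLpNorm (𝓕⁻ (θ n) : 𝓢(Rd d, ℂ)) 1 volume ≤ C * 2 ^ (-(2 * M : ℝ) * n) := by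
  obtain ⟨θ, hθ⟩ := exists_mul_norm_sq_pow_eq (θ := D.rhoSchwartz 1)
    (D.hasCompactSupport_ofReal_rho 1) (fun h => D.zero_notMem_tsupport_rho_one
      (tsupport_comp_subset Complex.ofReal_zero (D.rho 1) h)) M
  choose θ' hθ' using fun n : ℕ => exists_eq_comp_smul θ (c := ((2 : ℝ) ^ n)⁻¹) (by positivity)
  have hfin : MemLp (𝓕⁻ θ : 𝓢(Rd d, ℂ)) 1 volume := (𝓕⁻ θ : 𝓢(Rd d, ℂ)).memLp 1
  refine ⟨eLpNorm (𝓕⁻ θ : 𝓢(Rd d, ℂ)) 1 volume, hfin.2.ne,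
    fun n => ((((2 : ℂ) ^ n)⁻¹ ^ 2) ^ M) • θ' n, fun n => ⟨fun ξ => ?_, ?_⟩⟩
  · rw [smul_apply, smul_eq_mul, hθ', rhoSchwartz_apply, D.rho_scaling, ← rhoSchwartz_apply, ← hθ,
      norm_smul, Real.norm_of_nonneg (by positivity)]
    push_cast
    ring
  · have hc : ‖(((2 : ℂ) ^ n)⁻¹ ^ 2) ^ M‖ₑ = 2 ^ (-(2 * M : ℝ) * n) := by
      have htwo : ‖(2 : ℂ)‖ₑ = 2 := by
        rw [← ofReal_norm, RCLike.norm_ofNat, ENNReal.ofReal_ofNat]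
      rw [enorm_pow, enorm_pow, enorm_inv (pow_ne_zero _ two_ne_zero), enorm_pow, htwo,
        neg_mul,
        ENNReal.rpow_neg, ← pow_mul, ← ENNReal.inv_pow, ← pow_mul, ← ENNReal.rpow_natCast]
      push_cast
      rw [mul_comm]
    have hsmul : (𝓕⁻ ((((2 : ℂ) ^ n)⁻¹ ^ 2) ^ M • θ' n) : 𝓢(Rd d, ℂ)) =
        (((2 : ℂ) ^ n)⁻¹ ^ 2) ^ M • 𝓕⁻ (θ' n) := FourierTransform.fourierInv_smul _ _
    rw [hsmul, ← eLpNorm_fourierInv_scaling (by positivity) (hθ' n), mul_comm, ← hc]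
    exact (eLpNorm_const_smul _ _ _ _).le

theorem fourierMultiplierCLM_sum_window {n : ℕ} {u : 𝓢'(Rd d, ℂ)}
    (hu : FourierSupportedIn (D.windowSet n) u) {g : Rd d → ℂ} (hg : g.HasTemperateGrowth)
    {θ : 𝓢(Rd d, ℂ)} (hθ : ∀ ξ, θ ξ * g ξ = ∑ m ∈ window n, D.rhoSchwartz m ξ) :
    fourierMultiplierCLM ℂ g (fourierMultiplierCLM ℂ θ u) = u := by
  have hone : Set.EqOn (⇑θ * g) (fun _ => 1) (D.windowSet n) := fun ξ hξ => by
    rw [Pi.mul_apply, hθ]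
    simp only [rhoSchwartz_apply]
    rw [← Complex.ofReal_sum, D.sum_window_rho_eq_one hξ, Complex.ofReal_one]
  rw [fourierMultiplierCLM_fourierMultiplierCLM_apply θ.hasTemperateGrowth hg,
    hu.fourierMultiplierCLM_congr (θ.hasTemperateGrowth.mul hg) (.const 1) hone,
    fourierMultiplierCLM_const, one_smul, ContinuousLinearMap.id_apply]

theorem exists_mul_norm_sq_pow_eq_sum_window (M : ℕ) :
    ∃ C : ℝ≥0∞, C ≠ ∞ ∧ ∃ θ : ℕ → 𝓢(Rd d, ℂ), ∀ n : ℕ,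
      (∀ ξ, θ n ξ * ((‖ξ‖ ^ 2) ^ M : ℝ) = ∑ m ∈ window (n + 5), D.rhoSchwartz m ξ) ∧
      eLpNorm (𝓕⁻ (θ n) : 𝓢(Rd d, ℂ)) 1 volume ≤ C * 2 ^ (-(2 * M : ℝ) * n) := by
  obtain ⟨C, hC, θ, hθ⟩ := D.exists_mul_norm_sq_pow_eq_rhoSchwartz M
  have hwindow (n : ℕ) : window (n + 5) = (window (n + 4)).map (addRightEmbedding 1) := by
    rw [window, window, Finset.map_add_right_Icc]
    congr 1
  have hsum (n : ℕ) : ⇑(𝓕⁻ (∑ m ∈ window (n + 4), θ m) : 𝓢(Rd d, ℂ)) =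
      ∑ m ∈ window (n + 4), ⇑(𝓕⁻ (θ m) : 𝓢(Rd d, ℂ)) := by
    ext x
    rw [Finset.sum_apply, ← sum_apply]
    exact congrArg (· x) (map_sum (FourierTransform.fourierInvCLM ℂ 𝓢(Rd d, ℂ)) _ _)
  refine ⟨9 * C * 2 ^ (4 * |(2 * M : ℝ)|), ENNReal.mul_ne_top
    (ENNReal.mul_ne_top ENNReal.ofNat_ne_top hC) (two_rpow_ne_top _),
    fun n => ∑ m ∈ window (n + 4), θ m, fun n => ⟨fun ξ => ?_, ?_⟩⟩
  · rw [hwindow, Finset.sum_map, sum_apply, Finset.sum_mul]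
    exact Finset.sum_congr rfl fun m _ => (hθ m).1 ξ
  · have hle : -(2 * M : ℝ) * (n + 4 : ℕ) ≤ -(2 * M) * n := by
      push_cast
      nlinarith [(M.cast_nonneg : (0 : ℝ) ≤ M)]
    calc eLpNorm (𝓕⁻ (∑ m ∈ window (n + 4), θ m) : 𝓢(Rd d, ℂ)) 1 volume
        ≤ ∑ m ∈ window (n + 4), eLpNorm (𝓕⁻ (θ m) : 𝓢(Rd d, ℂ)) 1 volume := by
          rw [hsum]
          exact eLpNorm_sum_le (fun m _ =>
            (𝓕⁻ (θ m) : 𝓢(Rd d, ℂ)).continuous.aestronglyMeasurable) le_rfl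
      _ ≤ 9 * C * 2 ^ (4 * |(2 * M : ℝ)|) * 2 ^ (-(2 * M : ℝ) * (n + 4 : ℕ)) :=
          sum_window_le fun m _ => (hθ m).2
      _ ≤ _ := by
          gcongr
          exact one_le_two

/-- On the support of `𝓕 (u n)`, which is far from the origin for large `n`, one can divide by
`‖ξ‖ ^ (2 * M)`; for large `M` this gains enough decay for the series to converge in `L^∞`, and
multiplication by `‖ξ‖ ^ (2 * M)` preserves convergence of distributions. -/
theorem summable_of_fourierSupportedIn {γ : ℝ} {u : ℕ → 𝓢'(Rd d, ℂ)} (hu : HasDyadicDecay γ u)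
    (hS : ∀ n, FourierSupportedIn (D.windowSet n) (u n)) : Summable u := by
  obtain ⟨M, hM⟩ := exists_nat_gt (-γ / 2)
  obtain ⟨C, hC, θ, hθ⟩ := D.exists_mul_norm_sq_pow_eq_sum_window M
  have hgrowth : (fun ξ : Rd d => (((‖ξ‖ ^ 2) ^ M : ℝ) : ℂ)).HasTemperateGrowth := by fun_prop
  have hsum : Summable fun n => fourierMultiplierCLM ℂ (θ n) (u (n + 5)) :=
    ((hu.comp_add_right 5).fourierMultiplier hC fun n => (hθ n).2).summable (by linarith)
  refine (summable_nat_add_iff 5).1 ((hsum.map _ (ContinuousLinearMap.continuous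
    (fourierMultiplierCLM ℂ fun ξ : Rd d => (((‖ξ‖ ^ 2) ^ M : ℝ) : ℂ)))).congr fun n => ?_)
  exact D.fourierMultiplierCLM_sum_window (hS _) hgrowth (hθ n).1

variable {D} {β : ℝ} {v : 𝓢'(Rd d, ℂ)}

theorem MemHolder.paraConverges (hv : D.MemHolder β v) (F : LInfty (Rd d)) :
    D.ParaConverges (toDist F) v :=
  D.summable_of_fourierSupportedIn (hv.hasDyadicDecay_paraTerm F)
    (D.fourierSupportedIn_paraTerm F v)

theorem MemHolder.block_para (hv : D.MemHolder β v) (F : LInfty (Rd d)) (m : ℕ) :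
    D.block m (D.para (toDist F) v) =
      ∑ n ∈ window m, D.block m (D.paraTerm (toDist F) v n) := by
  rw [para, (D.block m).map_tsum (hv.paraConverges F)]
  exact tsum_eq_sum fun n hn => D.block_eq_zero_of_fourierSupportedIn
    (D.fourierSupportedIn_paraTerm F v n) (mem_window_comm.not.1 hn)

theorem hasDyadicDecay_sum_window_block (D : DyadicPartition d) {γ : ℝ} {u : ℕ → 𝓢'(Rd d, ℂ)}
    (hu : HasDyadicDecay γ u) : HasDyadicDecay γ fun m => ∑ n ∈ window m, D.block m (u n) := by
  have hfin := hu.linftyNorm_ne_top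
  obtain ⟨C, hC, hu⟩ := hu
  have hK (n : ℕ) : MemLp (D.kernel n) 1 volume := (D.kernel n).memLp 1
  refine hasDyadicDecay_sum_window (ENNReal.mul_ne_top (max_lt (hK 0).2 (hK 1).2).ne hC)
    fun m n => (linftyNorm_fourierMultiplierCLM_le (D.rhoSchwartz m) (hfin n)).trans ?_
  rw [mul_assoc]
  exact mul_le_mul' (D.eLpNorm_kernel_le m) (hu n)

theorem MemHolder.para (hv : D.MemHolder β v) (F : LInfty (Rd d)) :
    D.MemHolder β (D.para (toDist F) v) := by
  rw [memHolder_iff, funext (hv.block_para F)]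
  exact D.hasDyadicDecay_sum_window_block (hv.hasDyadicDecay_paraTerm F)

end DyadicPartition

/-! ### The remainder estimate -/

theorem enorm_le_twoParamHolderNorm_mul {α : ℝ} (hα : 0 ≤ α) {F : Rd d → Rd d → ℂ}
    (hF : twoParamHolderNorm α F ≠ ∞) (y z : Rd d) :
    ‖F y z‖ₑ ≤ twoParamHolderNorm α F * ‖y - z‖ₑ ^ α :=
  (ENNReal.div_le_iff_le_mul (.inr hF)
    (.inl (ENNReal.rpow_ne_top_of_nonneg hα enorm_ne_top))).1
    (le_iSup₂ (f := fun y z => ‖F y z‖ₑ / ‖y - z‖ₑ ^ α) y z)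

theorem rpow_le_two_rpow_mul_one_add_rpow {α : ℝ} (hα : 0 ≤ α) (k : ℕ) (t : ℝ≥0∞) :
    t ^ α ≤ 2 ^ (-α * k) * (1 + 2 ^ k * t) ^ α := by
  have hk : (2 : ℝ≥0∞) ^ (-α * k) * (2 ^ k) ^ α = 1 := by
    rw [← ENNReal.rpow_natCast_mul, ← two_rpow_add, neg_mul, mul_comm, neg_add_cancel,
      ENNReal.rpow_zero]
  calc t ^ α = 2 ^ (-α * k) * (2 ^ k * t) ^ α := by
        rw [ENNReal.mul_rpow_of_nonneg _ _ hα, ← mul_assoc, hk, one_mul]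
    _ ≤ 2 ^ (-α * k) * (1 + 2 ^ k * t) ^ α := by
        gcongr
        exact le_add_self

namespace DyadicPartition

section ParaBlock

variable (D : DyadicPartition d)

/-- The operator `F ↦ Δ_{k-1} (P_F g)` on bounded functions, where the bounded functions `G j` are
the blocks `Δ_{j-1} g`. -/
def paraBlock (G : ℕ → LInfty (Rd d)) (k : ℕ) : LInfty (Rd d) →ₗ[ℂ] LInfty (Rd d) :=
  ∑ j ∈ window k, conv (D.kernel k) ∘ₗ LinearMap.mulRight ℂ (G j) ∘ₗ conv (D.lowKernel j)

variable {D} {β : ℝ} {g : 𝓢'(Rd d, ℂ)} {G : ℕ → LInfty (Rd d)}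

theorem MemHolder.toDist_paraBlock (hg : D.MemHolder β g) (hG : ∀ j, toDist (G j) = D.block j g)
    (k : ℕ) (F : LInfty (Rd d)) :
    toDist (D.paraBlock G k F) = D.block k (D.para (toDist F) g) := by
  rw [hg.block_para, paraBlock, LinearMap.sum_apply, map_sum]
  refine Finset.sum_congr rfl fun j _ => ?_
  rw [paraTerm_toDist, ← hG, smulLeftCLM_toDist (hasTemperateGrowth_conv _ F), block_eq,
    fourierMultiplierCLM_toDist]
  rfl

theorem MemHolder.block_para_one (hg : D.MemHolder β g) {k : ℕ} (hk : 6 ≤ k) :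
    D.block k (D.para (toDist 1) g) = D.block k g := by
  rw [hg.block_para, ← D.sum_window_block_block k g]
  refine Finset.sum_congr rfl fun j hj => ?_
  have hj₂ : 2 ≤ j := by have := mem_window.1 hj; omega
  have hone : (conv (D.lowKernel j) 1).1 = fun _ => 1 := funext fun x => by
    rw [conv_one_apply, D.integral_lowKernel hj₂]
  rw [paraTerm_toDist, hone, smulLeftCLM_const, one_smul]

theorem weightBound_paraBlock {α : ℝ} (hα : 0 ≤ α) {C : ℝ≥0∞}
    (hC : ∀ j : ℕ, eLpNorm (G j).1 ∞ volume ≤ C * 2 ^ (-β * j)) {k : ℕ} (hk : 6 ≤ k) :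
    WeightBound α (2 ^ k)
      (9 * (2 ^ α * moment α 1 (D.kernel 1) * C * (64 ^ α * moment α 1 (D.kernel 0))) *
        2 ^ (4 * |β|) * 2 ^ (-β * k)) (D.paraBlock G k) := by
  refine (WeightBound.sum fun j _ => weightBound_conv_mul_conv hα (2 ^ k) (G j) (D.kernel k)
    (D.lowKernel j)).mono (sum_window_le fun j hj => ?_)
  obtain ⟨hkj, -⟩ := mem_window.1 hj
  calc moment α (2 ^ k) (D.kernel k) * eLpNorm (G j).1 ∞ volume * moment α (2 ^ k) (D.lowKernel j)
      ≤ 2 ^ α * moment α 1 (D.kernel 1) * (C * 2 ^ (-β * j)) *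
          (64 ^ α * moment α 1 (D.kernel 0)) := by
        gcongr
        · exact D.moment_kernel_le hα (by omega)
        · exact hC j
        · exact D.moment_lowKernel_le hα (by omega) hkj
    _ = _ := by ring

theorem MemHolder.exists_weightBound_paraBlock (hg : D.MemHolder β g) {α : ℝ} (hα : 0 ≤ α) :
    ∃ G : ℕ → LInfty (Rd d), (∀ j, toDist (G j) = D.block j g) ∧ ∃ M : ℝ≥0∞, M ≠ ∞ ∧
      ∀ k : ℕ, 6 ≤ k → WeightBound α (2 ^ k) (M * 2 ^ (-β * k)) (D.paraBlock G k) := by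
  have hblock := D.memHolder_iff.1 hg
  choose G hG using fun j => linftyNorm_ne_top_iff.1 (hblock.linftyNorm_ne_top j)
  obtain ⟨C, hC, hgC⟩ := hblock
  have hGC (j : ℕ) : eLpNorm (G j).1 ∞ volume ≤ C * 2 ^ (-β * j) := by
    rw [← linftyNorm_toDist, hG]
    exact hgC j
  have hmoment (K : 𝓢(Rd d, ℂ)) {c : ℝ≥0∞} (hc : c ≠ ∞) : c ^ α * moment α 1 K ≠ ∞ :=
    ENNReal.mul_ne_top (ENNReal.rpow_ne_top_of_nonneg hα hc)
      (moment_lt_top α ENNReal.one_ne_top K).ne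
  refine ⟨G, hG, _, ?_, fun k hk => weightBound_paraBlock hα hGC hk⟩
  exact ENNReal.mul_ne_top (ENNReal.mul_ne_top ENNReal.ofNat_ne_top (ENNReal.mul_ne_top
    (ENNReal.mul_ne_top (hmoment _ ENNReal.ofNat_ne_top) hC) (hmoment _ ENNReal.ofNat_ne_top)))
    (two_rpow_ne_top _)

end ParaBlock

variable (D : DyadicPartition d) {ι : Type*} [Fintype ι]

/-- The `k`-th term of the series for `∑ R°(a_n, b_n, g)`, minus `Δ_{k-1} (P_f g)` and plus the
`k`-th term of the series for `P_f g`; both corrections sum to `P_f g`. -/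
def remainderTerm (f : LInfty (Rd d)) (a b : ι → LInfty (Rd d)) (g : 𝓢'(Rd d, ℂ)) (k : ℕ) :
    𝓢'(Rd d, ℂ) :=
  ∑ n, (D.paraTerm (toDist (a n)) (D.para (toDist (b n)) g) k -
      D.paraTerm (toDist (a n * b n)) g k) -
    (D.block k (D.para (toDist f) g) - D.paraTerm (toDist f) g k)

variable {D} {β : ℝ} {g : 𝓢'(Rd d, ℂ)} (hg : D.MemHolder β g) (f : LInfty (Rd d))
  (a b : ι → LInfty (Rd d))

include hg

theorem MemHolder.linftyNorm_remainderTerm_ne_top (k : ℕ) :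
    linftyNorm (D.remainderTerm f a b g k) ≠ ∞ := by
  have hpara (v : 𝓢'(Rd d, ℂ)) {γ : ℝ} (hv : D.MemHolder γ v) (F : LInfty (Rd d)) :
      D.paraTerm (toDist F) v k ∈ LinearMap.range toDist :=
    linftyNorm_ne_top_iff.1 ((hv.hasDyadicDecay_paraTerm F).linftyNorm_ne_top k)
  have hblock := linftyNorm_ne_top_iff.1
    ((D.memHolder_iff.1 (hg.para f)).linftyNorm_ne_top k)
  exact linftyNorm_ne_top_iff.2 <| sub_mem
    (sum_mem fun n _ => sub_mem (hpara _ (hg.para (b n)) (a n)) (hpara _ hg (a n * b n)))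
    (sub_mem hblock (hpara _ hg f))

theorem MemHolder.remainderTerm_eq {G : ℕ → LInfty (Rd d)}
    (hG : ∀ j, toDist (G j) = D.block j g) {k : ℕ} (hk : 6 ≤ k) :
    D.remainderTerm f a b g k =
      toDist (averagingDefect (D.lowKernel k) (D.paraBlock G k) f a b) := by
  have hmul (F H : LInfty (Rd d)) : toDist (conv (D.lowKernel k) F * H) =
      smulLeftCLM ℂ (conv (D.lowKernel k) F).1 (toDist H) :=
    (smulLeftCLM_toDist (hasTemperateGrowth_conv _ F) H).symm
  simp only [remainderTerm, averagingDefect, map_sub, map_sum, hmul, hg.toDist_paraBlock hG,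
    hg.block_para_one hk, paraTerm_toDist]

theorem MemHolder.hasDyadicDecay_remainderTerm {α : ℝ} (hα : 0 ≤ α) {H : ℝ≥0∞} (hH : H ≠ ∞)
    (hrem : ∀ x y, ‖(expansionRemainder f a b x).1 y‖ₑ ≤ H * ‖y - x‖ₑ ^ α) :
    HasDyadicDecay (α + β) (D.remainderTerm f a b g) := by
  obtain ⟨G, hG, M, hM, hweight⟩ := hg.exists_weightBound_paraBlock hα
  set A := 64 ^ α * moment α 1 (D.kernel 0)
  have hA : A ≠ ∞ := ENNReal.mul_ne_top (ENNReal.rpow_ne_top_of_nonneg hα ENNReal.ofNat_ne_top)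
    (moment_lt_top α ENNReal.one_ne_top _).ne
  refine .of_forall_ge (ENNReal.mul_ne_top hA (ENNReal.mul_ne_top hM hH))
    (hg.linftyNorm_remainderTerm_ne_top f a b) (N := 6) fun k hk => ?_
  have hrem_k (x y : Rd d) : ‖(expansionRemainder f a b x).1 y‖ₑ ≤
      H * 2 ^ (-α * k) * (1 + 2 ^ k * ‖y - x‖ₑ) ^ α := by
    rw [mul_assoc]
    exact (hrem x y).trans (by gcongr; exact rpow_le_two_rpow_mul_one_add_rpow hα k _)
  rw [hg.remainderTerm_eq f a b hG hk, linftyNorm_toDist, eLpNorm_exponent_top]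
  refine (eLpNormEssSup_le_of_ae_enorm_bound (.of_forall (enorm_averagingDefect_le hα
    (D.integral_lowKernel (by omega)) (hweight k hk) hrem_k))).trans ?_
  calc _ ≤ A * (M * 2 ^ (-β * k) * (H * 2 ^ (-α * k))) := by
        gcongr
        exact D.moment_lowKernel_le hα (by omega) (by omega)
    _ = _ := by
        rw [neg_add, add_mul, two_rpow_add]
        ring

theorem MemHolder.block_sum_Rcirc (m : ℕ) :
    D.block m (∑ n, D.Rcirc (a n).1 (b n).1 (a n).2 (b n).2 g) =
      ∑ k ∈ window m, D.block m (D.remainderTerm f a b g k) := by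
  have hRcirc (n : ι) : D.block m (D.Rcirc (a n).1 (b n).1 (a n).2 (b n).2 g) =
      ∑ k ∈ window m, D.block m (D.paraTerm (toDist (a n)) (D.para (toDist (b n)) g) k -
        D.paraTerm (toDist (a n * b n)) g k) := by
    simp only [map_sub, Finset.sum_sub_distrib]
    rw [← (hg.para (b n)).block_para, ← hg.block_para, ← map_sub]
    rfl
  have hcancel : ∑ k ∈ window m, D.block m (D.block k (D.para (toDist f) g) -
      D.paraTerm (toDist f) g k) = 0 := by
    simp only [map_sub, Finset.sum_sub_distrib]
    rw [D.sum_window_block_block, ← hg.block_para, sub_self]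
  have hsum : ∑ k ∈ window m, D.block m (D.remainderTerm f a b g k) =
      ∑ k ∈ window m, D.block m (∑ n, (D.paraTerm (toDist (a n)) (D.para (toDist (b n)) g) k -
        D.paraTerm (toDist (a n * b n)) g k)) := by
    rw [← sub_zero (∑ k ∈ window m, D.block m (∑ n, _)), ← hcancel, ← Finset.sum_sub_distrib]
    exact Finset.sum_congr rfl fun k _ => map_sub _ _ _
  simp only [hsum, map_sum, hRcirc]
  exact Finset.sum_comm

theorem MemHolder.sum_Rcirc {α : ℝ} (hα : 0 ≤ α) {H : ℝ≥0∞} (hH : H ≠ ∞)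
    (hrem : ∀ x y, ‖(expansionRemainder f a b x).1 y‖ₑ ≤ H * ‖y - x‖ₑ ^ α) :
    D.MemHolder (α + β) (∑ n, D.Rcirc (a n).1 (b n).1 (a n).2 (b n).2 g) := by
  rw [D.memHolder_iff, funext (hg.block_sum_Rcirc f a b)]
  exact D.hasDyadicDecay_sum_window_block (hg.hasDyadicDecay_remainderTerm f a b hα hH hrem)

end DyadicPartition

end Paracontrolled

end

theorem mainTheorem5 {d : ℕ} (D : Paracontrolled.DyadicPartition d) (α : ℝ) (hα : 0 < α)
    (f : Paracontrolled.Rd d → ℂ) (hf : MemLp f ∞ volume)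
    (N : ℕ) (a b : Fin N → Paracontrolled.Rd d → ℂ)
    (ha : ∀ n, MemLp (a n) ∞ volume) (hb : ∀ n, MemLp (b n) ∞ volume)
    (fsharp : Paracontrolled.Rd d → Paracontrolled.Rd d → ℂ)
    (hsharp : Paracontrolled.twoParamHolderNorm α fsharp < ∞)
    (hfab : ∀ x y, f y - f x = (∑ n, a n x * (b n y - b n x)) + fsharp y x)
    (β : ℝ) (g : 𝓢'(Paracontrolled.Rd d, ℂ)) (hg : D.MemHolder β g) :
    (∀ n, D.RcircConverges (a n) (b n) (ha n) (hb n) g) ∧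
      D.MemHolder (α + β) (∑ n, D.Rcirc (a n) (b n) (ha n) (hb n) g) := by
  let F : Paracontrolled.LInfty (Paracontrolled.Rd d) := ⟨f, hf⟩
  let A (n : Fin N) : Paracontrolled.LInfty (Paracontrolled.Rd d) := ⟨a n, ha n⟩
  let B (n : Fin N) : Paracontrolled.LInfty (Paracontrolled.Rd d) := ⟨b n, hb n⟩
  have hrem (x y : Paracontrolled.Rd d) :
      (Paracontrolled.expansionRemainder F A B x).1 y = fsharp y x := by
    simp [Paracontrolled.expansionRemainder, F, A, B, hfab]
  refine ⟨fun n => ⟨hg.paraConverges (B n), (hg.para (B n)).paraConverges (A n),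
    hg.paraConverges (A n * B n)⟩, hg.sum_Rcirc F A B hα.le hsharp.ne fun x y => ?_⟩
  rw [hrem]
  exact Paracontrolled.enorm_le_twoParamHolderNorm_mul hα.le hsharp.ne y x
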